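/- For a finite positive Borel measure $\nu$ of compact support put $\mathcal E(\nu)=\iint \log|x-y|^{-1}\,d\nu(x)\,d\nu(y)\in(-\infty,+\infty]$. For a compact set $E$, the capacity is $C(E)=\exp\bigl(-\inf_\nu \mathcal E(\nu)\bigr)$, the infimum being over the Borel probability measures on $E$ ($C(E)=0$ if all these energies are $+\infty$); if $C(E)>0$, the equilibrium measure $\rho_E$ is the unique probability measure on $E$ of minimal energy. A closed set $E\subset\mathbb R$ is essentially perfect if $|E\cap(x-\delta,x+\delta)|>0$ for all $x\in E$ and $\delta>0$, where $|\cdot|$ is Lebesgue measure. **Theorem 4.2.** Let $\mu$ be a finite positive Borel measure on $\mathbb R$ with compact support, and let $E\subset\operatorname{supp}\mu$ be an essentially perfect compact set with $C(E)>0$. Suppose that $\rho_E$ is absolutely continuous with respect to $\mu$. Let $P_n$ be the monic orthogonal polynomials of $\mu$ ($P_n$ is monic of degree $n$ and $\int P_nP_m\,d\mu=0$ for $n\ne m$), and let $\nu_n$ be the zero counting measure of $P_n$, that is, $\frac1n\sum_{i=1}^n\delta_{z_i}$, where $z_1,\dots,z_n$ are the zeros of $P_n$ in $\mathbb C$ counted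 with multiplicity. If for some $n(1)<n(2)<\cdots$ $$\|P_{n(j)}\|_{L^2(\mathbb R,d\mu)}^{1/n(j)}\longrightarrow C(E)\qquad(j\to\infty),$$ then $\nu_{n(j)}$ converges weakly to $\rho_E$, that is, $\int f\,d\nu_{n(j)}\to\int f\,d\rho_E$ for every bounded continuous function $f$. -/

import Mathlib

open MeasureTheory Filter Topology Polynomial
open scoped ENNReal BoundedContinuousFunction

/-! ### Logarithmic potential theory (used for the line and for the plane) -/

/-- The Lebesgue integral of an extended-real function, as the integral of the positive part minus
that of the negative part. It is meaningful whenever one of the two is finite. -/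
noncomputable def eIntegral {X : Type*} [MeasurableSpace X] (ν : Measure X) (f : X → EReal) :
    EReal :=
  ((∫⁻ x, (f x).toENNReal ∂ν : ℝ≥0∞) : EReal) - ((∫⁻ x, (-f x).toENNReal ∂ν : ℝ≥0∞) : EReal)

/-- The kernel `log |x - y|⁻¹`, with value `+∞` on the diagonal. -/
noncomputable def logKernel {X : Type*} [MetricSpace X] (x y : X) : EReal :=
  ENNReal.log (edist x y)⁻¹

/-- The Coulomb energy `∬ log |x - y|⁻¹ dν(x) dν(y)`. The kernel is bounded below on bounded sets,
so for a finite measure carried by a compact set this is a well-defined element of `(-∞, +∞]`. -/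
noncomputable def logEnergy {X : Type*} [MetricSpace X] [MeasurableSpace X] (ν : Measure X) :
    EReal :=
  eIntegral (ν.prod ν) (fun p => logKernel p.1 p.2)

/-- The probability measures carried by `E`. -/
def probOn {X : Type*} [MeasurableSpace X] (E : Set X) : Set (Measure X) :=
  {ν | IsProbabilityMeasure ν ∧ ν Eᶜ = 0}

/-- The logarithmic capacity of a compact set: `exp (-inf energy)`, hence `0` when every
probability measure on `E` has infinite energy. -/
noncomputable def logCapacity {X : Type*} [MetricSpace X] [MeasurableSpace X] (E : Set X) : ℝ :=
  (EReal.exp (-⨅ ν ∈ probOn E, logEnergy ν)).toReal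

/-- `ρ` is a probability measure on `E` of least energy. For compact `E` of positive capacity
there is exactly one. -/
def IsEquilibriumMeasure {X : Type*} [MetricSpace X] [MeasurableSpace X] (E : Set X)
    (ρ : Measure X) : Prop :=
  ρ ∈ probOn E ∧ ∀ ν ∈ probOn E, logEnergy ρ ≤ logEnergy ν

open Classical in
/-- The equilibrium measure of a compact set of positive capacity. -/
noncomputable def equilibriumMeasure {X : Type*} [MetricSpace X] [MeasurableSpace X] (E : Set X) :
    Measure X :=
  if h : ∃ ρ, IsEquilibriumMeasure E ρ then h.choose else 0

/-- A closed set of reals is essentially perfect if each neighbourhood of each of its points meets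
it in positive Lebesgue measure. -/
def EssentiallyPerfect (E : Set ℝ) : Prop :=
  IsClosed E ∧ ∀ x ∈ E, ∀ δ > 0, 0 < volume (E ∩ Set.Ioo (x - δ) (x + δ))

/-! ### Orthogonal polynomials and their zeros -/

/-- The monic orthogonal polynomials of `μ`, by the Gram-Schmidt process applied to the powers
of `x` in `L²(μ)`. -/
noncomputable def monicOP (μ : Measure ℝ) (n : ℕ) : ℝ[X] :=
  X ^ n - ∑ k : Fin n,
    C ((∫ x, x ^ n * (monicOP μ k).eval x ∂μ) / ∫ x, (monicOP μ k).eval x ^ 2 ∂μ) * monicOP μ k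
termination_by n
decreasing_by all_goals exact k.2

/-- The `n`-th polynomial is monic of degree `n`. -/
theorem monicOP_monic (μ : Measure ℝ) (n : ℕ) :
    (monicOP μ n).Monic ∧ (monicOP μ n).natDegree = n := by
  induction n using Nat.strong_induction_on with
  | _ n ih =>
    have hlt : (∑ k : Fin n, C ((∫ x, x ^ n * (monicOP μ k).eval x ∂μ) /
        ∫ x, (monicOP μ k).eval x ^ 2 ∂μ) * monicOP μ k).degree < (n : WithBot ℕ) := by
      rw [← mem_degreeLT]
      refine Submodule.sum_mem _ fun k _ => mem_degreeLT.2 ?_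
      refine lt_of_le_of_lt ((degree_mul_le _ _).trans
        ((add_le_add_left degree_C_le _).trans_eq (zero_add _))) ?_
      have h := ih k k.2
      rw [degree_eq_natDegree h.1.ne_zero, h.2]
      exact_mod_cast k.2
    have hm := (monic_X_pow (R := ℝ) n).sub_of_left (hlt.trans_eq (degree_X_pow n).symm)
    rw [monicOP]
    refine ⟨hm, ?_⟩
    have hd := degree_sub_eq_left_of_degree_lt (hlt.trans_eq (degree_X_pow (R := ℝ) n).symm)
    rw [degree_X_pow] at hd
    exact natDegree_eq_of_degree_eq_some hd

/-- Distinct polynomials of the sequence are orthogonal in `L²(μ)`, as soon as all moments are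
finite and `μ` does not vanish on the square of any of them (that is, has infinite support). -/
theorem monicOP_orthogonal (μ : Measure ℝ)
    (hint : ∀ p : ℝ[X], Integrable (fun x => p.eval x) μ)
    (hpos : ∀ n, ∫ x, (monicOP μ n).eval x ^ 2 ∂μ ≠ 0) {m n : ℕ} (hmn : m ≠ n) :
    ∫ x, (monicOP μ m).eval x * (monicOP μ n).eval x ∂μ = 0 := by
  have key : ∀ n, ∀ m < n, ∫ x, (monicOP μ m).eval x * (monicOP μ n).eval x ∂μ = 0 := by
    intro n
    induction n using Nat.strong_induction_on with
    | _ n ih =>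
      intro m hm
      set c : ℕ → ℝ := fun k =>
        (∫ x, x ^ n * (monicOP μ k).eval x ∂μ) / ∫ x, (monicOP μ k).eval x ^ 2 ∂μ with hc
      have hev : ∀ x, (monicOP μ m).eval x * (monicOP μ n).eval x =
          x ^ n * (monicOP μ m).eval x -
            ∑ k : Fin n, c k * ((monicOP μ m).eval x * (monicOP μ k).eval x) := by
        intro x
        rw [monicOP.eq_1 μ n]
        simp only [eval_sub, eval_pow, eval_X, eval_finsetSum, eval_mul, eval_C, mul_sub,
          Finset.mul_sum, hc]
        congr 1
        · ring
        · exact Finset.sum_congr rfl fun k _ => by ring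
      have hi1 : Integrable (fun x => x ^ n * (monicOP μ m).eval x) μ := by
        have h := hint (X ^ n * monicOP μ m)
        have he : ∀ x : ℝ, (X ^ n * monicOP μ m).eval x = x ^ n * (monicOP μ m).eval x := by
          intro x
          rw [eval_mul, eval_pow, eval_X]
        simpa only [he] using h
      have hi2 : ∀ k : ℕ,
          Integrable (fun x => c k * ((monicOP μ m).eval x * (monicOP μ k).eval x)) μ := by
        intro k
        simpa only [eval_mul, eval_C] using hint (C (c k) * (monicOP μ m * monicOP μ k))
      simp only [hev]
      rw [integral_sub hi1 (integrable_finsetSum (Finset.univ : Finset (Fin n)) fun k _ => hi2 k),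
        integral_finsetSum _ fun (k : Fin n) _ => hi2 k, Finset.sum_eq_single (⟨m, hm⟩ : Fin n)]
      · simp only [integral_const_mul, ← pow_two, hc]
        rw [div_mul_cancel₀ _ (hpos m), sub_self]
      · intro k _ hk
        have hkm : (k : ℕ) ≠ m := fun h => hk (Fin.ext h)
        rw [integral_const_mul]
        rcases lt_or_gt_of_ne hkm with h | h
        · have := ih m hm k h
          simp only [mul_comm] at this ⊢
          rw [this, zero_mul]
        · rw [ih k k.2 m h, mul_zero]
      · simp
  rcases lt_or_gt_of_ne hmn with h | h
  · exact key n m h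
  · simpa only [mul_comm] using key m n h

/-- The normalized zero counting measure of a polynomial: `1 / deg p` times the sum of the point
masses at its complex zeros, with multiplicity. -/
noncomputable def zeroCountingMeasure (p : ℂ[X]) : Measure ℂ :=
  (p.natDegree : ℝ≥0∞)⁻¹ • (p.roots.map Measure.dirac).sum

/-- Weak convergence of measures: convergence of the integrals of all bounded continuous
functions. -/
def ConvergesWeakly {X : Type*} [TopologicalSpace X] [MeasurableSpace X] (ν : ℕ → Measure X)
    (ρ : Measure X) : Prop :=
  ∀ f : X →ᵇ ℝ, Tendsto (fun j => ∫ x, f x ∂(ν j)) atTop (𝓝 (∫ x, f x ∂ρ))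

/-! ### Integrals against measures carried by a compact set -/

/-! Put `L = log C(E)`, let `ρ` be the equilibrium measure, and enclose `supp μ` in `[-R, R]`. The
hypothesis says that the orthogonal polynomials are, in root asymptotics, no larger than `exp (n *
L)` in mean square. Chebyshev and Borel-Cantelli turn this into a pointwise bound `exp (n * (L +
ε))`, valid eventually at μ-almost every point, hence at ρ-almost every point by absolute continuity
(`ae_eventually_abs_le`). The first variation of the energy shows that the potential `∫ log |x - y|
dρ(y)` equals `L` at ρ-almost every `x` (`IsEquilibriumMeasure.ae_integral_log_eq`). Both facts
hold, uniformly in the point and for all late indices, on one compact set `F` with `ρ(F) ≥ 1 - ε`.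
No regularity of `E` is needed.

The measure `ρ` conditioned on `F` has potential at least `L - O(ε)` on `F`, and this lower bound
extends to the whole plane. A maximum principle of Bernstein-Walsh type (`sum_log_norm_sub_le`) then
bounds `(1/n) log |P_n(z)|` off `F` and off the zeros by the potential of the conditioned measure
plus `O(ε)`. At `z = 1/w` with `w` small, subtracting `log |1/w|` gives `∫ log |1 - x w| dν_n ≤ ∫
log |1 - x w| dρ + O(ε)`, uniformly in `w` (`average_log_norm_one_sub_le`).

This one-sided bound suffices. Both sides without the error are harmonic in `w` and vanish at `0`,
so averages over rotated roots of unity bound each moment difference from both sides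
(`mul_moment_sub_le`). The zeros are real and lie in `[-R, R]`, so convergence of moments is weak
convergence, by Weierstrass approximation. -/

theorem ContinuousOn.integrable_of_measure_compl {X : Type*} [TopologicalSpace X]
    [MeasurableSpace X] [OpensMeasurableSpace X] [T2Space X] {ν : Measure X} [IsFiniteMeasure ν]
    {K : Set X} (hK : IsCompact K) (hν : ν Kᶜ = 0) {f : X → ℝ} (hf : ContinuousOn f K) :
    Integrable f ν := by
  have h := hf.integrableOn_compact (μ := ν) hK
  rwa [IntegrableOn, Measure.restrict_eq_self_of_ae_mem (show ∀ᵐ x ∂ν, x ∈ K from hν)] at h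

theorem abs_integral_le_of_measure_compl {X : Type*} [MeasurableSpace X] {ν : Measure X}
    [IsFiniteMeasure ν] {K : Set X} (hν : ν Kᶜ = 0) {f : X → ℝ} {C : ℝ}
    (hf : ∀ x ∈ K, |f x| ≤ C) : |∫ x, f x ∂ν| ≤ C * ν.real Set.univ := by
  have hK : ∀ᵐ x ∂ν, x ∈ K := hν
  have h : ∀ᵐ x ∂ν, ‖f x‖ ≤ C := hK.mono fun x hx => hf x hx
  exact norm_integral_le_of_norm_le_const h

/-! ### Convergence of measures from one-sided bounds on logarithmic integrals -/

theorem abs_log_one_sub_add_le {y : ℝ} (h : |y| ≤ 1 / 2) : |Real.log (1 - y) + y| ≤ 2 * y ^ 2 := by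
  have h1 := Real.abs_log_sub_add_sum_range_le (x := y) (by linarith) 1
  simp only [Finset.sum_range_one, zero_add, pow_one, Nat.cast_zero, div_one, Nat.reduceAdd,
    sq_abs] at h1
  rw [add_comm]
  refine h1.trans ?_
  rw [div_le_iff₀ (by linarith)]
  nlinarith [sq_nonneg y]

/-- This is the factorization `1 - a ^ q = ∏ (1 - a ζ)` over the roots of unity. Since `‖a‖ < 1`, no
factor vanishes and the logarithm is additive. The sum removes every moment of order not divisible
by `q`. -/
theorem sum_log_norm_one_sub_mul_root {q : ℕ} (hq : 0 < q) {a : ℂ} (ha : ‖a‖ < 1) :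
    ∑ ζ ∈ nthRootsFinset q (1 : ℂ), Real.log ‖1 - a * ζ‖ = Real.log ‖1 - a ^ q‖ := by
  have h := (Complex.isPrimitiveRoot_exp q hq.ne').pow_sub_pow_eq_prod_sub_mul 1 a hq
  rw [one_pow] at h
  rw [h, norm_prod, Real.log_prod]
  · exact Finset.sum_congr rfl fun ζ _ => by rw [mul_comm]
  · intro ζ hζ h0
    have h1 : ‖ζ‖ = 1 :=
      Complex.norm_eq_one_of_pow_eq_one ((mem_nthRootsFinset hq 1).1 hζ) hq.ne'
    have h2 : ζ * a = 1 := (sub_eq_zero.1 (norm_eq_zero.1 h0)).symm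
    have h3 := congrArg norm h2
    rw [norm_mul, h1, one_mul, norm_one] at h3
    linarith

theorem one_half_le_norm_one_sub {a : ℂ} (ha : ‖a‖ ≤ 1 / 2) : 1 / 2 ≤ ‖1 - a‖ := by
  have := norm_sub_norm_le (1 : ℂ) a
  rw [norm_one] at this
  linarith

theorem norm_ofReal_mul_le_half {R x : ℝ} (hR : 0 < R) (hx : x ∈ Set.Icc (-R) R) {w : ℂ}
    (hw : ‖w‖ ≤ 1 / (2 * R)) : ‖(x : ℂ) * w‖ ≤ 1 / 2 := by
  rw [norm_mul, Complex.norm_real, Real.norm_eq_abs]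
  calc |x| * ‖w‖ ≤ R * (1 / (2 * R)) := by
        gcongr
        exact abs_le.2 hx
    _ = 1 / 2 := by field_simp

theorem continuousOn_log_norm_one_sub {R : ℝ} (hR : 0 < R) {w : ℂ} (hw : ‖w‖ ≤ 1 / (2 * R)) :
    ContinuousOn (fun x : ℝ => Real.log ‖1 - (x : ℂ) * w‖) (Set.Icc (-R) R) := by
  refine ContinuousOn.log (by fun_prop) fun x hx => ?_
  have := one_half_le_norm_one_sub (norm_ofReal_mul_le_half hR hx hw)
  linarith

/-- Summing the hypothesis over the points `w ζ` with `w ^ q = t` replaces the integrand by `log (1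
- t x ^ q) = -t x ^ q + O(t ^ 2)`. The sign of `t` is free, so a one-sided hypothesis controls the
moments from both sides. The constant `4` is two quadratic remainders with constant `2`. -/
theorem mul_moment_sub_le {R δ : ℝ} (hR : 0 < R) {ν ρ : Measure ℝ} [IsProbabilityMeasure ν]
    [IsProbabilityMeasure ρ] (hν : ν (Set.Icc (-R) R)ᶜ = 0) (hρ : ρ (Set.Icc (-R) R)ᶜ = 0)
    (h : ∀ w : ℂ, ‖w‖ ≤ 1 / (2 * R) → ∫ x : ℝ, Real.log ‖1 - (x : ℂ) * w‖ ∂ν ≤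
      ∫ x : ℝ, Real.log ‖1 - (x : ℂ) * w‖ ∂ρ + δ)
    {q : ℕ} (hq : 0 < q) {t : ℝ} (ht : |t| ≤ (1 / (2 * R)) ^ q) :
    t * (∫ x, x ^ q ∂ρ - ∫ x, x ^ q ∂ν) ≤ q * δ + 4 * (R ^ q) ^ 2 * t ^ 2 := by
  obtain ⟨w, hw⟩ := IsAlgClosed.exists_pow_nat_eq (t : ℂ) hq
  have hwn : ‖w‖ ≤ 1 / (2 * R) := by
    rw [← pow_le_pow_iff_left₀ (norm_nonneg w) (by positivity) hq.ne', ← norm_pow, hw,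
      Complex.norm_real]
    exact ht
  have hwζ : ∀ ζ ∈ nthRootsFinset q (1 : ℂ), ‖w * ζ‖ ≤ 1 / (2 * R) := by
    intro ζ hζ
    rw [norm_mul, Complex.norm_eq_one_of_pow_eq_one ((mem_nthRootsFinset hq 1).1 hζ) hq.ne',
      mul_one]
    exact hwn
  have hsum : ∀ τ : Measure ℝ, IsProbabilityMeasure τ → τ (Set.Icc (-R) R)ᶜ = 0 →
      ∑ ζ ∈ nthRootsFinset q (1 : ℂ), ∫ x : ℝ, Real.log ‖1 - (x : ℂ) * (w * ζ)‖ ∂τ =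
        ∫ x : ℝ, Real.log (1 - t * x ^ q) ∂τ := by
    intro τ _ hτ
    rw [← integral_finsetSum _ fun ζ hζ =>
      (continuousOn_log_norm_one_sub hR (hwζ ζ hζ)).integrable_of_measure_compl isCompact_Icc hτ]
    have hK : ∀ᵐ x ∂τ, x ∈ Set.Icc (-R) R := hτ
    refine integral_congr_ae (hK.mono fun x hx => ?_)
    have h1 := norm_ofReal_mul_le_half hR hx hwn
    have h2 := sum_log_norm_one_sub_mul_root hq (a := (x : ℂ) * w) (by linarith)
    simp only [mul_assoc] at h2 ⊢
    rw [h2, mul_pow, hw]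
    have h3 : (1 - (x : ℂ) ^ q * t) = ((1 - t * x ^ q : ℝ) : ℂ) := by push_cast; ring
    rw [h3, Complex.norm_real, Real.norm_eq_abs, Real.log_abs]
  have hcard : (nthRootsFinset q (1 : ℂ)).card = q :=
    (Complex.isPrimitiveRoot_exp q hq.ne').card_nthRootsFinset
  have key : ∫ x : ℝ, Real.log (1 - t * x ^ q) ∂ν ≤
      ∫ x : ℝ, Real.log (1 - t * x ^ q) ∂ρ + q * δ := by
    rw [← hsum ν inferInstance hν, ← hsum ρ inferInstance hρ]
    refine (Finset.sum_le_sum fun ζ hζ => h _ (hwζ ζ hζ)).trans_eq ?_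
    rw [Finset.sum_add_distrib, Finset.sum_const, hcard, nsmul_eq_mul]
  have hxq : ∀ x ∈ Set.Icc (-R) R, |x ^ q| ≤ R ^ q := fun x hx => by
    rw [abs_pow]; gcongr; exact abs_le.2 hx
  have htx : ∀ x ∈ Set.Icc (-R) R, |t * x ^ q| ≤ 1 / 2 := by
    intro x hx
    rw [abs_mul]
    calc |t| * |x ^ q| ≤ (1 / (2 * R)) ^ q * R ^ q := by gcongr; exact hxq x hx
      _ = (1 / 2) ^ q := by rw [← mul_pow]; congr 1; field_simp
      _ ≤ 1 / 2 := pow_le_of_le_one (by norm_num) (by norm_num) hq.ne'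
  have hlog : ∀ τ : Measure ℝ, IsProbabilityMeasure τ → τ (Set.Icc (-R) R)ᶜ = 0 →
      |∫ x : ℝ, Real.log (1 - t * x ^ q) ∂τ + t * ∫ x, x ^ q ∂τ| ≤ 2 * (R ^ q) ^ 2 * t ^ 2 := by
    intro τ _ hτ
    rw [← integral_const_mul, ← integral_add]
    · have := abs_integral_le_of_measure_compl (ν := τ) (C := 2 * (R ^ q) ^ 2 * t ^ 2) hτ
        (f := fun x => Real.log (1 - t * x ^ q) + t * x ^ q) fun x hx => ?_
      · simpa using this
      · refine (abs_log_one_sub_add_le (htx x hx)).trans ?_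
        have h1 : (x ^ q) ^ 2 ≤ (R ^ q) ^ 2 := sq_le_sq' (neg_le_of_abs_le (hxq x hx))
          (le_of_abs_le (hxq x hx))
        rw [mul_pow]
        nlinarith [sq_nonneg t]
    · refine ContinuousOn.integrable_of_measure_compl isCompact_Icc hτ
        (ContinuousOn.log (by fun_prop) fun x hx => ?_)
      have := (abs_le.1 (htx x hx)).2
      linarith
    · exact ContinuousOn.integrable_of_measure_compl isCompact_Icc hτ (by fun_prop)
  have h1 := abs_le.1 (hlog ν inferInstance hν)
  have h2 := abs_le.1 (hlog ρ inferInstance hρ)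
  linarith [h1.1, h2.2]

theorem tendsto_moment_of_log_integral_le {R : ℝ} (hR : 0 < R) {ν : ℕ → Measure ℝ}
    {ρ : Measure ℝ} [∀ j, IsProbabilityMeasure (ν j)] [IsProbabilityMeasure ρ]
    (hν : ∀ j, ν j (Set.Icc (-R) R)ᶜ = 0) (hρ : ρ (Set.Icc (-R) R)ᶜ = 0)
    (h : ∀ δ > 0, ∀ᶠ j in atTop, ∀ w : ℂ, ‖w‖ ≤ 1 / (2 * R) →
      ∫ x : ℝ, Real.log ‖1 - (x : ℂ) * w‖ ∂(ν j) ≤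
        ∫ x : ℝ, Real.log ‖1 - (x : ℂ) * w‖ ∂ρ + δ) (q : ℕ) :
    Tendsto (fun j => ∫ x, x ^ q ∂(ν j)) atTop (𝓝 (∫ x, x ^ q ∂ρ)) := by
  rcases Nat.eq_zero_or_pos q with rfl | hq
  · simp
  rw [Metric.tendsto_atTop']
  intro ε hε
  set c : ℝ := 4 * (R ^ q) ^ 2 with hc
  have hc0 : 0 < c := by positivity
  -- The bound on `t` makes the quadratic error at most `t * ε / 4`. The tolerance `t * ε / (4 * q)`
  -- taken below contributes as much again, and division by `t` leaves `ε / 2`.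
  set t : ℝ := min ((1 / (2 * R)) ^ q) (ε / (4 * c)) with ht
  have ht0 : 0 < t := lt_min (by positivity) (by positivity)
  have htc : c * t ≤ ε / 4 := by
    calc c * t ≤ c * (ε / (4 * c)) := by gcongr; exact min_le_right _ _
      _ = ε / 4 := by field_simp
  have hq' : (0 : ℝ) < q := by exact_mod_cast hq
  obtain ⟨N, hN⟩ := eventually_atTop.1 (h (t * ε / (4 * q)) (by positivity))
  refine ⟨N, fun j hj => ?_⟩
  have e1 : (q : ℝ) * (t * ε / (4 * q)) = t * (ε / 4) := by field_simp
  have h1 := mul_moment_sub_le hR (hν j) hρ (hN j hj.le) hq (t := t)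
    (by rw [abs_of_pos ht0]; exact min_le_left _ _)
  have h2 := mul_moment_sub_le hR (hν j) hρ (hN j hj.le) hq (t := -t)
    (by rw [abs_neg, abs_of_pos ht0]; exact min_le_left _ _)
  rw [e1, ← hc] at h1 h2
  set d := ∫ x, x ^ q ∂ρ - ∫ x, x ^ q ∂(ν j) with hd
  have h3 : d ≤ ε / 2 := by
    refine le_of_mul_le_mul_left (h1.trans ?_) ht0
    nlinarith
  have h4 : -d ≤ ε / 2 := by
    refine le_of_mul_le_mul_left (le_trans (by linarith) (h2.trans ?_)) ht0
    nlinarith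
  rw [dist_comm, Real.dist_eq, ← hd]
  exact lt_of_le_of_lt (abs_le.2 ⟨by linarith, h3⟩) (by linarith)

theorem tendsto_integral_of_tendsto_moment {R : ℝ} {ν : ℕ → Measure ℝ}
    {ρ : Measure ℝ} [∀ j, IsProbabilityMeasure (ν j)] [IsProbabilityMeasure ρ]
    (hν : ∀ j, ν j (Set.Icc (-R) R)ᶜ = 0) (hρ : ρ (Set.Icc (-R) R)ᶜ = 0)
    (h : ∀ q : ℕ, Tendsto (fun j => ∫ x, x ^ q ∂(ν j)) atTop (𝓝 (∫ x, x ^ q ∂ρ)))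
    {f : ℝ → ℝ} (hf : Continuous f) :
    Tendsto (fun j => ∫ x, f x ∂(ν j)) atTop (𝓝 (∫ x, f x ∂ρ)) := by
  have hint : ∀ τ : Measure ℝ, IsProbabilityMeasure τ → τ (Set.Icc (-R) R)ᶜ = 0 →
      ∀ g : ℝ → ℝ, Continuous g → Integrable g τ := fun τ _ hτ g hg =>
    hg.continuousOn.integrable_of_measure_compl isCompact_Icc hτ
  have hpoly : ∀ p : ℝ[X], Tendsto (fun j => ∫ x, p.eval x ∂(ν j)) atTop
      (𝓝 (∫ x, p.eval x ∂ρ)) := by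
    intro p
    have e : ∀ τ : Measure ℝ, IsProbabilityMeasure τ → τ (Set.Icc (-R) R)ᶜ = 0 →
        ∫ x, p.eval x ∂τ = ∑ i ∈ Finset.range (p.natDegree + 1), p.coeff i * ∫ x, x ^ i ∂τ := by
      intro τ _ hτ
      simp_rw [eval_eq_sum_range]
      rw [integral_finsetSum _ fun i _ => hint τ inferInstance hτ _ (by fun_prop)]
      simp_rw [integral_const_mul]
    simp_rw [fun j => e (ν j) inferInstance (hν j), e ρ inferInstance hρ]
    exact tendsto_finsetSum _ fun i _ => (h i).const_mul _
  rw [Metric.tendsto_atTop']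
  intro ε hε
  obtain ⟨p, hp⟩ := exists_polynomial_near_of_continuousOn (-R) R f hf.continuousOn (ε / 3)
    (by linarith)
  obtain ⟨N, hN⟩ := Metric.tendsto_atTop'.1 (hpoly p) (ε / 3) (by linarith)
  have hnear : ∀ τ : Measure ℝ, IsProbabilityMeasure τ → τ (Set.Icc (-R) R)ᶜ = 0 →
      |∫ x, p.eval x ∂τ - ∫ x, f x ∂τ| ≤ ε / 3 := by
    intro τ _ hτ
    rw [← integral_sub (hint τ inferInstance hτ _ p.continuous) (hint τ inferInstance hτ _ hf)]
    simpa using abs_integral_le_of_measure_compl hτ fun x hx => (hp x hx).le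
  refine ⟨N, fun j hj => ?_⟩
  have h1 := abs_le.1 (hnear (ν j) inferInstance (hν j))
  have h2 := abs_le.1 (hnear ρ inferInstance hρ)
  have h3 := abs_lt.1 (hN j hj)
  rw [Real.dist_eq, abs_lt]
  constructor <;> linarith [h1.1, h1.2, h2.1, h2.2, h3.1, h3.2]

/-! ### Zeros of orthogonal polynomials -/

section OrthogonalPolynomials

variable {μ : Measure ℝ} [IsFiniteMeasure μ]

theorem Continuous.integrable_of_isCompact_support (hμ : IsCompact μ.support) {f : ℝ → ℝ}
    (hf : Continuous f) : Integrable f μ :=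
  hf.continuousOn.integrable_of_measure_compl hμ Measure.measure_compl_support

/-- The set where `q` does not vanish is open. If it were null, it would miss the support, which
would then lie in the finite set of roots. -/
theorem integral_norm_sq_eval_pos (hμ : IsCompact μ.support) (hinf : μ.support.Infinite)
    {q : ℂ[X]} (hq : q ≠ 0) : 0 < ∫ x : ℝ, ‖q.eval (x : ℂ)‖ ^ 2 ∂μ := by
  have hc : Continuous fun x : ℝ => ‖q.eval (x : ℂ)‖ ^ 2 := by fun_prop
  rw [integral_pos_iff_support_of_nonneg (fun x => sq_nonneg _)
    (hc.integrable_of_isCompact_support hμ)]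
  by_contra h0
  have h0 : μ (Function.support fun x : ℝ => ‖q.eval (x : ℂ)‖ ^ 2) = 0 := by simpa using h0
  have hsub := Measure.subset_compl_support_of_isOpen hc.isOpen_support h0
  have hfin : (((↑) : ℝ → ℂ) ⁻¹' (q.roots.toFinset : Set ℂ)).Finite :=
    (Finset.finite_toSet _).preimage Complex.ofReal_injective.injOn
  refine hinf (hfin.subset fun x hx => ?_)
  have h1 : ‖q.eval (x : ℂ)‖ ^ 2 = 0 := by
    by_contra h2
    exact hsub h2 hx
  have h2 : q.eval (x : ℂ) = 0 := by simpa using h1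
  simp [hq, h2]

theorem eval_map_ofReal (p : ℝ[X]) (x : ℝ) :
    (p.map (algebraMap ℝ ℂ)).eval (x : ℂ) = ((p.eval x : ℝ) : ℂ) := by
  rw [← Complex.coe_algebraMap, eval_map_algebraMap, aeval_algebraMap_apply_eq_algebraMap_eval]

theorem integral_monicOP_sq_pos (hμ : IsCompact μ.support) (hinf : μ.support.Infinite) (n : ℕ) :
    0 < ∫ x, (monicOP μ n).eval x ^ 2 ∂μ := by
  have h := integral_norm_sq_eval_pos hμ hinf (q := (monicOP μ n).map (algebraMap ℝ ℂ))
    ((monicOP_monic μ n).1.map _).ne_zero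
  simpa only [eval_map_ofReal, Complex.norm_real, Real.norm_eq_abs, sq_abs] using h

/-- The Gram-Schmidt recursion, read backwards, writes `x ^ k` as a combination of the orthogonal
polynomials of degree at most `k`. -/
theorem integral_pow_mul_monicOP (hμ : IsCompact μ.support) (hinf : μ.support.Infinite)
    {k n : ℕ} (hk : k < n) : ∫ x, x ^ k * (monicOP μ n).eval x ∂μ = 0 := by
  have hint : ∀ p : ℝ[X], Integrable (fun x => p.eval x) μ := fun p =>
    p.continuous.integrable_of_isCompact_support hμ
  have horth : ∀ i, i < n → ∫ x, (monicOP μ i).eval x * (monicOP μ n).eval x ∂μ = 0 :=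
    fun i hi => monicOP_orthogonal μ hint
      (fun m => (integral_monicOP_sq_pos hμ hinf m).ne') hi.ne
  have hX := monicOP.eq_1 μ k
  rw [eq_sub_iff_add_eq] at hX
  have hx : ∀ x : ℝ, x ^ k * (monicOP μ n).eval x =
      (monicOP μ k).eval x * (monicOP μ n).eval x + ∑ i : Fin k,
        ((∫ x, x ^ k * (monicOP μ i).eval x ∂μ) / ∫ x, (monicOP μ i).eval x ^ 2 ∂μ) *
          ((monicOP μ i).eval x * (monicOP μ n).eval x) := by
    intro x
    have := congrArg (eval x) hX
    simp only [eval_add, eval_finsetSum, eval_mul, eval_C, eval_pow, eval_X] at this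
    rw [← this, add_mul, Finset.sum_mul]
    simp only [mul_assoc]
  have hi : ∀ i : ℕ, Integrable (fun x => (monicOP μ i).eval x * (monicOP μ n).eval x) μ :=
    fun i => ((monicOP μ i).continuous.mul
      (monicOP μ n).continuous).integrable_of_isCompact_support hμ
  set c : ℕ → ℝ := fun i =>
    (∫ x, x ^ k * (monicOP μ i).eval x ∂μ) / ∫ x, (monicOP μ i).eval x ^ 2 ∂μ with hc
  have hi2 : ∀ i : ℕ,
      Integrable (fun x => c i * ((monicOP μ i).eval x * (monicOP μ n).eval x)) μ :=
    fun i => (hi i).const_mul _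
  simp only [hx]
  rw [integral_add (hi k) (integrable_finsetSum (Finset.univ : Finset (Fin k)) fun i _ => hi2 i),
    horth k hk, integral_finsetSum _ fun (i : Fin k) _ => hi2 i, zero_add]
  refine Finset.sum_eq_zero fun i _ => ?_
  rw [integral_const_mul, horth i (i.2.trans hk), mul_zero]

theorem integral_eval_mul_monicOP (hμ : IsCompact μ.support) (hinf : μ.support.Infinite)
    {n : ℕ} {q : ℂ[X]} (hq : q.natDegree < n) :
    ∫ x : ℝ, q.eval (x : ℂ) * (((monicOP μ n).eval x : ℝ) : ℂ) ∂μ = 0 := by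
  have hx : ∀ x : ℝ, q.eval (x : ℂ) * (((monicOP μ n).eval x : ℝ) : ℂ) =
      ∑ i ∈ Finset.range (q.natDegree + 1),
        q.coeff i * ((x ^ i * (monicOP μ n).eval x : ℝ) : ℂ) := by
    intro x
    rw [eval_eq_sum_range, Finset.sum_mul]
    exact Finset.sum_congr rfl fun i _ => by push_cast; ring
  have hi : ∀ i : ℕ, Integrable (fun x : ℝ => x ^ i * (monicOP μ n).eval x) μ := fun i =>
    ((continuous_pow i).mul (monicOP μ n).continuous).integrable_of_isCompact_support hμ
  simp_rw [hx]
  rw [integral_finsetSum _ fun i _ => (hi i).ofReal.const_mul _]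
  refine Finset.sum_eq_zero fun i h => ?_
  rw [integral_const_mul, integral_complex_ofReal, integral_pow_mul_monicOP hμ hinf
    (lt_of_lt_of_le (Finset.mem_range.1 h) hq)]
  simp

/-- Write `P = (X - z) Q`. Orthogonality of `P` to the conjugate of `Q` reads `∫ (x - z) ‖Q‖ ^ 2 dμ
= 0`, so `z` is the mean of `x` with respect to the positive weight `‖Q‖ ^ 2 μ`. -/
theorem exists_ofReal_eq_of_mem_roots_monicOP (hμ : IsCompact μ.support)
    (hinf : μ.support.Infinite) {R : ℝ} (hR : μ.support ⊆ Set.Icc (-R) R) {n : ℕ} {z : ℂ}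
    (hz : z ∈ ((monicOP μ n).map (algebraMap ℝ ℂ)).roots) :
    ∃ x ∈ Set.Icc (-R) R, (x : ℂ) = z := by
  set P := (monicOP μ n).map (algebraMap ℝ ℂ) with hP
  have hPm : P.Monic := (monicOP_monic μ n).1.map _
  have hPd : P.natDegree = n := by rw [hP, natDegree_map, (monicOP_monic μ n).2]
  obtain ⟨Q, hQ⟩ := dvd_iff_isRoot.2 (isRoot_of_mem_roots hz)
  have hQm : Q.Monic := by
    refine Monic.of_mul_monic_left (monic_X_sub_C z) ?_
    rw [← hQ]; exact hPm
  have hQd : Q.natDegree < n := by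
    have := (monic_X_sub_C z).natDegree_mul hQm
    rw [← hQ, hPd, natDegree_X_sub_C] at this
    omega
  have hc : ∀ x : ℝ, (Q.map (starRingEnd ℂ)).eval (x : ℂ) = starRingEnd ℂ (Q.eval (x : ℂ)) := by
    intro x
    have := eval_map_apply (starRingEnd ℂ) (p := Q) (x : ℂ)
    rwa [Complex.conj_ofReal] at this
  have h0 := integral_eval_mul_monicOP hμ hinf (n := n) (q := Q.map (starRingEnd ℂ))
    (natDegree_map_le.trans_lt hQd)
  have hx : ∀ x : ℝ, (Q.map (starRingEnd ℂ)).eval (x : ℂ) * (((monicOP μ n).eval x : ℝ) : ℂ) =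
      ((x * ‖Q.eval (x : ℂ)‖ ^ 2 : ℝ) : ℂ) - z * ((‖Q.eval (x : ℂ)‖ ^ 2 : ℝ) : ℂ) := by
    intro x
    rw [← eval_map_ofReal, ← hP, hQ, hc, eval_mul, eval_sub, eval_X, eval_C]
    push_cast
    rw [← Complex.conj_mul']
    ring
  have hi1 : Integrable (fun x : ℝ => x * ‖Q.eval (x : ℂ)‖ ^ 2) μ :=
    Continuous.integrable_of_isCompact_support hμ (by fun_prop)
  have hi2 : Integrable (fun x : ℝ => ‖Q.eval (x : ℂ)‖ ^ 2) μ :=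
    Continuous.integrable_of_isCompact_support hμ (by fun_prop)
  simp_rw [hx] at h0
  rw [integral_sub hi1.ofReal (hi2.ofReal.const_mul _), integral_const_mul, integral_complex_ofReal,
    integral_complex_ofReal, sub_eq_zero] at h0
  have hpos := integral_norm_sq_eval_pos hμ hinf hQm.ne_zero
  set a := ∫ x : ℝ, x * ‖Q.eval (x : ℂ)‖ ^ 2 ∂μ
  set b := ∫ x : ℝ, ‖Q.eval (x : ℂ)‖ ^ 2 ∂μ with hb
  have hbd : ∀ᵐ x ∂μ, x ∈ Set.Icc (-R) R := by
    filter_upwards [Measure.support_mem_ae (μ := μ)] with x hx using hR hx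
  refine ⟨a / b, ⟨?_, ?_⟩, ?_⟩
  · rw [le_div_iff₀ hpos, hb, ← integral_const_mul]
    refine integral_mono_ae (hi2.const_mul _) hi1 (hbd.mono fun x hx => ?_)
    exact mul_le_mul_of_nonneg_right hx.1 (sq_nonneg _)
  · rw [div_le_iff₀ hpos, hb, ← integral_const_mul]
    refine integral_mono_ae hi1 (hi2.const_mul _) (hbd.mono fun x hx => ?_)
    exact mul_le_mul_of_nonneg_right hx.2 (sq_nonneg _)
  · have hb0 : (b : ℂ) ≠ 0 := by exact_mod_cast hpos.ne'
    push_cast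
    rw [h0]
    field_simp

theorem exists_roots_monicOP (hμ : IsCompact μ.support) (hinf : μ.support.Infinite) {R : ℝ}
    (hR : μ.support ⊆ Set.Icc (-R) R) (n : ℕ) :
    ∃ s : Multiset ℝ, s.card = n ∧ (∀ x ∈ s, x ∈ Set.Icc (-R) R) ∧
      ((monicOP μ n).map (algebraMap ℝ ℂ)).roots = s.map (fun x : ℝ => (x : ℂ)) := by
  set P := (monicOP μ n).map (algebraMap ℝ ℂ) with hP
  have hmem := fun z hz => exists_ofReal_eq_of_mem_roots_monicOP hμ hinf hR (n := n) (z := z) hz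
  rw [← hP] at hmem
  refine ⟨P.roots.map Complex.re, ?_, ?_, ?_⟩
  · rw [Multiset.card_map, IsAlgClosed.card_roots_eq_natDegree, hP, natDegree_map,
      (monicOP_monic μ n).2]
  · intro x hx
    obtain ⟨z, hz, rfl⟩ := Multiset.mem_map.1 hx
    obtain ⟨y, hy, rfl⟩ := hmem z hz
    simpa using hy
  · rw [Multiset.map_map]
    conv_lhs => rw [← Multiset.map_id P.roots]
    refine Multiset.map_congr rfl fun z hz => ?_
    obtain ⟨y, hy, rfl⟩ := hmem z hz
    simp

end OrthogonalPolynomials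

/-! ### Logarithmic potentials of measures on the line -/

section LogPotential

variable {F : Set ℝ} {σ : Measure ℝ} [IsProbabilityMeasure σ]

theorem integrable_log_norm_sub (hF : IsCompact F) (hσ : σ Fᶜ = 0) {z : ℂ}
    (hz : z ∉ ((↑) : ℝ → ℂ) '' F) : Integrable (fun t : ℝ => Real.log ‖z - t‖) σ := by
  refine ContinuousOn.integrable_of_measure_compl hF hσ (ContinuousOn.log (by fun_prop) ?_)
  intro t ht h0
  exact hz ⟨t, ht, (sub_eq_zero.1 (norm_eq_zero.1 h0)).symm⟩

theorem integrable_log_abs_sub (hF : IsCompact F) (hσ : σ Fᶜ = 0) {x : ℝ} (hx : x ∉ F) :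
    Integrable (fun t : ℝ => Real.log |x - t|) σ := by
  refine ContinuousOn.integrable_of_measure_compl hF hσ (ContinuousOn.log (by fun_prop) ?_)
  intro t ht h0
  rw [abs_eq_zero, sub_eq_zero] at h0
  exact hx (h0 ▸ ht)

/-- On the real line, lower bounds for `∫ log |x - t| dσ(t)` propagate from a set carrying `σ` to
the whole line, because the logarithm is concave on the gaps of the set. -/
theorem neg_le_integral_log_abs_sub (hF : IsCompact F) (hσ : σ Fᶜ = 0) {c : ℝ}
    (hatom : ∀ x ∈ F, σ {x} = 0) (hint : ∀ x ∈ F, Integrable (fun t => Real.log |x - t|) σ)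
    (hc : ∀ x ∈ F, -c ≤ ∫ t, Real.log |x - t| ∂σ) {x : ℝ} (hx : x ∉ F) :
    -c ≤ ∫ t, Real.log |x - t| ∂σ := by
  have hFae : ∀ᵐ t ∂σ, t ∈ F := hσ
  -- As `Real.log 0 = 0`, comparison of logarithms can fail at `t = y`. The absence of atoms makes
  -- that point negligible.
  have hne : ∀ y ∈ F, ∀ᵐ t ∂σ, t ≠ y := fun y hy => by
    rw [ae_iff]; simpa using hatom y hy
  have hix := integrable_log_abs_sub hF hσ hx
  have hFn : F.Nonempty := by
    by_contra h
    rw [Set.not_nonempty_iff_eq_empty.1 h, Set.compl_empty, measure_univ] at hσ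
    exact one_ne_zero hσ
  have one_sided : ∀ y ∈ F, (∀ t ∈ F, |y - t| ≤ |x - t|) → -c ≤ ∫ t, Real.log |x - t| ∂σ := by
    intro y hy h
    refine (hc y hy).trans (integral_mono_ae (hint y hy) hix ?_)
    filter_upwards [hFae, hne y hy] with t ht hty
    exact Real.log_le_log (abs_pos.2 (sub_ne_zero.2 hty.symm)) (h t ht)
  have hl : IsCompact (F ∩ Set.Iic x) := hF.inter_right isClosed_Iic
  have hr : IsCompact (F ∩ Set.Ici x) := hF.inter_right isClosed_Ici
  rcases (F ∩ Set.Iic x).eq_empty_or_nonempty with hle | hln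
  · have hr' : (F ∩ Set.Ici x).Nonempty := by
      obtain ⟨t, ht⟩ := hFn
      refine ⟨t, ht, ?_⟩
      by_contra h
      have : t ∈ F ∩ Set.Iic x := ⟨ht, Set.mem_Iic.2 (le_of_not_ge fun h' => h (Set.mem_Ici.2 h'))⟩
      rw [hle] at this
      exact this
    obtain ⟨b, hb, hbm⟩ := hr.exists_isLeast hr'
    refine one_sided b hb.1 fun t ht => ?_
    have hxt : x ≤ t := by
      by_contra h
      have : t ∈ F ∩ Set.Iic x := ⟨ht, (not_le.1 h).le⟩
      rw [hle] at this
      exact this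
    have hbt := hbm ⟨ht, hxt⟩
    have hxb : x ≤ b := hb.2
    rw [abs_sub_comm b, abs_sub_comm x, abs_of_nonneg (by linarith), abs_of_nonneg (by linarith)]
    linarith
  obtain ⟨a, ha, ham⟩ := hl.exists_isGreatest hln
  have hxa : a ≤ x := ha.2
  rcases (F ∩ Set.Ici x).eq_empty_or_nonempty with hre | hrn
  · refine one_sided a ha.1 fun t ht => ?_
    have hxt : t ≤ x := by
      by_contra h
      have : t ∈ F ∩ Set.Ici x := ⟨ht, (not_le.1 h).le⟩
      rw [hre] at this
      exact this
    have hbt := ham ⟨ht, hxt⟩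
    rw [abs_of_nonneg (by linarith), abs_of_nonneg (by linarith)]
    linarith
  obtain ⟨b, hb, hbm⟩ := hr.exists_isLeast hrn
  have hxb : x ≤ b := hb.2
  have hax : a < x := lt_of_le_of_ne hxa fun h => hx (h ▸ ha.1)
  have hbx : x < b := lt_of_le_of_ne hxb fun h => hx (h ▸ hb.1)
  set s := (x - a) / (b - a) with hs
  have hba : 0 < b - a := by linarith
  have hs0 : 0 ≤ s := div_nonneg (by linarith) hba.le
  have hs1 : 0 ≤ 1 - s := by
    rw [hs, sub_nonneg, div_le_one hba]; linarith
  have hsx : (1 - s) * a + s * b = x := by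
    rw [hs]; field_simp; ring
  have hlow : ∀ᵐ t ∂σ, (1 - s) * Real.log |a - t| + s * Real.log |b - t| ≤ Real.log |x - t| := by
    filter_upwards [hFae, hne a ha.1, hne b hb.1] with t ht hta htb
    have ht' : t ≤ a ∨ b ≤ t := by
      rcases le_total t x with h | h
      · exact Or.inl (ham ⟨ht, h⟩)
      · exact Or.inr (hbm ⟨ht, h⟩)
    -- No point of `F` lies strictly between `a` and `b`, so `|· - t|` is affine on the gap for each
    -- `t` in `F`.
    have hcomb : |x - t| = (1 - s) * |a - t| + s * |b - t| := by
      rcases ht' with h | h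
      · rw [abs_of_nonneg (by linarith), abs_of_nonneg (by linarith), abs_of_nonneg (by linarith)]
        linarith
      · rw [abs_of_nonpos (by linarith), abs_of_nonpos (by linarith), abs_of_nonpos (by linarith)]
        linarith
    rw [hcomb]
    have := strictConcaveOn_log_Ioi.concaveOn.2 (abs_pos.2 (sub_ne_zero.2 hta.symm))
      (abs_pos.2 (sub_ne_zero.2 htb.symm)) hs1 hs0 (by ring)
    simpa only [smul_eq_mul] using this
  have hia := (hint a ha.1).const_mul (1 - s)
  have hib := (hint b hb.1).const_mul s
  refine le_trans ?_ (integral_mono_ae (hia.add hib) hix hlow)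
  simp only [Pi.add_apply]
  rw [integral_add hia hib, integral_const_mul, integral_const_mul]
  nlinarith [hc a ha.1, hc b hb.1]

/-- Projecting `z` to the real axis only decreases its distances to the points of `F`, which reduces
the bound to the real line. -/
theorem neg_le_integral_log_norm_sub (hF : IsCompact F) (hσ : σ Fᶜ = 0) {c : ℝ}
    (hatom : ∀ x ∈ F, σ {x} = 0) (hint : ∀ x ∈ F, Integrable (fun t => Real.log |x - t|) σ)
    (hc : ∀ x ∈ F, -c ≤ ∫ t, Real.log |x - t| ∂σ) {z : ℂ} (hz : z ∉ ((↑) : ℝ → ℂ) '' F) :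
    -c ≤ ∫ t : ℝ, Real.log ‖z - t‖ ∂σ := by
  have hFae : ∀ᵐ t ∂σ, t ∈ F := hσ
  have hre : ∀ t : ℝ, |z.re - t| ≤ ‖z - t‖ := fun t => by
    simpa using Complex.abs_re_le_norm (z - t)
  have hiz := integrable_log_norm_sub hF hσ hz
  by_cases hx : z.re ∈ F
  · refine (hc _ hx).trans (integral_mono_ae (hint _ hx) hiz ?_)
    have hne : ∀ᵐ t ∂σ, t ≠ z.re := by
      rw [ae_iff]; simpa using hatom _ hx
    filter_upwards [hne] with t ht
    exact Real.log_le_log (abs_pos.2 (sub_ne_zero.2 ht.symm)) (hre t)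
  · refine (neg_le_integral_log_abs_sub hF hσ hatom hint hc hx).trans
      (integral_mono_ae (integrable_log_abs_sub hF hσ hx) hiz ?_)
    filter_upwards [hFae] with t ht
    refine Real.log_le_log (abs_pos.2 (sub_ne_zero.2 fun h => hx (h ▸ ht))) (hre t)

theorem continuousAt_integral_log_norm_sub (hF : IsCompact F) (hσ : σ Fᶜ = 0) {z : ℂ}
    (hz : z ∉ ((↑) : ℝ → ℂ) '' F) :
    ContinuousAt (fun z : ℂ => ∫ t : ℝ, Real.log ‖z - t‖ ∂σ) z := by
  have hFae : ∀ᵐ t ∂σ, t ∈ F := hσ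
  have hcl : IsClosed (((↑) : ℝ → ℂ) '' F) := (hF.image Complex.continuous_ofReal).isClosed
  obtain ⟨d, hd, hball⟩ := Metric.nhds_basis_closedBall.mem_iff.1 (hcl.isOpen_compl.mem_nhds hz)
  have hne : ∀ y ∈ Metric.closedBall z d, ∀ t ∈ F, y - (t : ℂ) ≠ 0 := fun y hy t ht h0 =>
    hball hy ⟨t, ht, (sub_eq_zero.1 h0).symm⟩
  obtain ⟨C, hC⟩ := ((isCompact_closedBall z d).prod hF).exists_bound_of_continuousOn
    (f := fun p : ℂ × ℝ => Real.log ‖p.1 - p.2‖)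
    (ContinuousOn.log (by fun_prop) fun p hp => norm_ne_zero_iff.2 (hne _ hp.1 _ hp.2))
  have hmem : ∀ᶠ y in 𝓝 z, y ∈ Metric.closedBall z d := Metric.closedBall_mem_nhds z hd
  refine continuousAt_of_dominated (bound := fun _ => C) ?_ ?_ (integrable_const C) ?_
  · filter_upwards [hmem] with y hy
    exact (integrable_log_norm_sub hF hσ (hball hy)).aestronglyMeasurable
  · filter_upwards [hmem] with y hy
    filter_upwards [hFae] with t ht
    exact hC (y, t) ⟨hy, ht⟩
  · filter_upwards [hFae] with t ht
    exact ContinuousAt.log (by fun_prop)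
      (norm_ne_zero_iff.2 (hne z (Metric.mem_closedBall_self hd.le) t ht))

end LogPotential

/-! ### A discrete Laplacian of the logarithm -/

/-- The sum of `f` over the four points at distance `h` from `z` in the coordinate directions. -/
noncomputable def crossSum (f : ℂ → ℝ) (z : ℂ) (h : ℝ) : ℝ :=
  f (z + h) + f (z - h) + f (z + h * Complex.I) + f (z - h * Complex.I)

theorem crossSum_norm_sq (z : ℂ) (h : ℝ) :
    crossSum (fun z => ‖z‖ ^ 2) z h = 4 * ‖z‖ ^ 2 + 4 * h ^ 2 := by
  simp only [crossSum, Complex.sq_norm, Complex.normSq_apply]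
  simp
  ring

theorem abs_log_norm_one_sub_le {a : ℂ} (ha : ‖a‖ ≤ 1 / 2) : |Real.log ‖1 - a‖| ≤ 2 * ‖a‖ := by
  have h1 := one_half_le_norm_one_sub ha
  have h2 : ‖1 - a‖ ≤ 1 + ‖a‖ := by simpa using norm_sub_le (1 : ℂ) a
  have h3 : 1 - ‖a‖ ≤ ‖1 - a‖ := by simpa using norm_sub_norm_le (1 : ℂ) a
  have hpos : 0 < ‖1 - a‖ := by linarith
  rw [abs_le]
  constructor
  · have h4 := Real.one_sub_inv_le_log_of_pos hpos
    have h5 : ‖1 - a‖⁻¹ ≤ 1 + 2 * ‖a‖ := by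
      rw [inv_le_comm₀ hpos (by positivity), inv_le_iff_one_le_mul₀ (by positivity)]
      nlinarith [norm_nonneg a]
    linarith
  · have h4 := Real.log_le_sub_one_of_pos hpos
    linarith [norm_nonneg a]

/-- The four factors `w ± h`, `w ± i h` multiply to `w ^ 4 - h ^ 4`, so the discrete Laplacian is
exactly `log ‖1 - h ^ 4 / w ^ 4‖`. Its order `h ^ 4` is negligible beside the `4 * h ^ 2` produced
by `‖z‖ ^ 2`, which yields a maximum principle without derivatives. -/
theorem abs_crossSum_log_norm_sub_le {d h : ℝ} (hh : 0 < h) (hd : 2 * h ≤ d) {z a : ℂ}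
    (hz : d ≤ ‖z - a‖) :
    |crossSum (fun z => Real.log ‖z - a‖) z h - 4 * Real.log ‖z - a‖| ≤ 2 * h ^ 4 / d ^ 4 := by
  set w := z - a with hw
  have hd0 : 0 < d := by linarith
  have hw0 : w ≠ 0 := norm_pos_iff.1 (by linarith)
  have hn : ∀ v : ℂ, ‖v‖ = h → ‖w + v‖ ≠ 0 := by
    intro v hv h0
    have : w = -v := eq_neg_of_add_eq_zero_left (norm_eq_zero.1 h0)
    rw [this, norm_neg, hv] at hz
    linarith
  have e1 : ‖(h : ℂ)‖ = h := by rw [Complex.norm_real, Real.norm_eq_abs, abs_of_pos hh]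
  have e2 : ‖(h : ℂ) * Complex.I‖ = h := by rw [norm_mul, Complex.norm_I, e1, mul_one]
  have n1 := hn h e1
  have n2 := hn (-h) (by rw [norm_neg, e1])
  have n3 := hn (h * Complex.I) e2
  have n4 := hn (-(h * Complex.I)) (by rw [norm_neg, e2])
  have hcross : crossSum (fun z => Real.log ‖z - a‖) z h =
      4 * Real.log ‖w‖ + Real.log ‖1 - (h : ℂ) ^ 4 / w ^ 4‖ := by
    have s1 : z + h - a = w + h := by rw [hw]; ring
    have s2 : z - h - a = w + -h := by rw [hw]; ring
    have s3 : z + h * Complex.I - a = w + h * Complex.I := by rw [hw]; ring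
    have s4 : z - h * Complex.I - a = w + -(h * Complex.I) := by rw [hw]; ring
    simp only [crossSum, s1, s2, s3, s4]
    rw [← Real.log_mul n1 n2, ← Real.log_mul (mul_ne_zero n1 n2) n3,
      ← Real.log_mul (mul_ne_zero (mul_ne_zero n1 n2) n3) n4, ← norm_mul, ← norm_mul, ← norm_mul]
    have hprod : (w + h) * (w + -h) * (w + h * Complex.I) * (w + -(h * Complex.I)) =
        w ^ 4 * (1 - (h : ℂ) ^ 4 / w ^ 4) := by
      have : (w + h) * (w + -h) * (w + h * Complex.I) * (w + -(h * Complex.I)) =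
          (w ^ 2 - h ^ 2) * (w ^ 2 - h ^ 2 * Complex.I ^ 2) := by ring
      rw [this, Complex.I_sq]
      field_simp
      ring
    have hne : ‖1 - (h : ℂ) ^ 4 / w ^ 4‖ ≠ 0 := by
      intro h0
      have h1 := congrArg norm hprod
      rw [norm_mul (w ^ 4), h0, mul_zero, norm_mul, norm_mul, norm_mul] at h1
      exact (mul_ne_zero (mul_ne_zero (mul_ne_zero n1 n2) n3) n4) h1
    rw [hprod, norm_mul, Real.log_mul (by simpa using hw0) hne, norm_pow, Real.log_pow]
    norm_num
  have hsmall : ‖(h : ℂ) ^ 4 / w ^ 4‖ ≤ h ^ 4 / d ^ 4 := by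
    rw [norm_div, norm_pow, norm_pow, e1]
    gcongr
  have hhalf : h ^ 4 / d ^ 4 ≤ 1 / 2 := by
    rw [div_le_iff₀ (by positivity)]
    have : (2 * h) ^ 4 ≤ d ^ 4 := by gcongr
    nlinarith [pow_pos hh 4]
  rw [hcross, add_sub_cancel_left]
  refine (abs_log_norm_one_sub_le (hsmall.trans hhalf)).trans ?_
  rw [mul_div_assoc]
  linarith

/-! ### The Bernstein-Walsh inequality on the line -/

section BernsteinWalsh

variable {F : Set ℝ} {σ : Measure ℝ} [IsProbabilityMeasure σ]

theorem le_crossSum_integral_log_norm_sub (hF : IsCompact F) (hσ : σ Fᶜ = 0) {z : ℂ} {d h : ℝ}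
    (hh : 0 < h) (hd : 2 * h ≤ d) (hz : ∀ t ∈ F, d ≤ ‖z - (t : ℂ)‖) :
    crossSum (fun z => ∫ t : ℝ, Real.log ‖z - t‖ ∂σ) z h ≤
      4 * ∫ t : ℝ, Real.log ‖z - t‖ ∂σ + 2 * h ^ 4 / d ^ 4 := by
  have hFae : ∀ᵐ t ∂σ, t ∈ F := hσ
  have hi : ∀ v : ℂ, ‖v‖ < d → Integrable (fun t : ℝ => Real.log ‖z + v - t‖) σ := by
    intro v hv
    refine integrable_log_norm_sub hF hσ ?_
    rintro ⟨t, ht, h0⟩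
    have := hz t ht
    rw [h0, sub_add_cancel_left, norm_neg] at this
    linarith
  have e1 : ‖(h : ℂ)‖ = h := by rw [Complex.norm_real, Real.norm_eq_abs, abs_of_pos hh]
  have e2 : ‖(h : ℂ) * Complex.I‖ = h := by rw [norm_mul, Complex.norm_I, e1, mul_one]
  have i0 : Integrable (fun t : ℝ => Real.log ‖z - t‖) σ := by
    simpa using hi 0 (by rw [norm_zero]; linarith)
  have i1 := hi h (by linarith)
  have i2 := hi (-h) (by rw [norm_neg]; linarith)
  have i3 := hi (h * Complex.I) (by linarith)
  have i4 := hi (-(h * Complex.I)) (by rw [norm_neg]; linarith)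
  simp only [← sub_eq_add_neg] at i2 i4
  simp only [crossSum]
  have i12 : Integrable (fun t : ℝ => Real.log ‖z + h - t‖ + Real.log ‖z - h - t‖) σ := i1.add i2
  have i123 : Integrable (fun t : ℝ => Real.log ‖z + h - t‖ + Real.log ‖z - h - t‖ +
    Real.log ‖z + h * Complex.I - t‖) σ := i12.add i3
  rw [← integral_add i1 i2, ← integral_add i12 i3, ← integral_add i123 i4,
    ← integral_const_mul]
  have hconst : 2 * h ^ 4 / d ^ 4 = ∫ _ : ℝ, 2 * h ^ 4 / d ^ 4 ∂σ := by simp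
  rw [hconst, ← integral_add (i0.const_mul 4) (integrable_const _)]
  refine integral_mono_ae (i123.add i4)
    ((i0.const_mul 4).add (integrable_const _)) ?_
  filter_upwards [hFae] with t ht
  have := (abs_le.1 (abs_crossSum_log_norm_sub_le hh hd (hz t ht))).2
  simp only [crossSum] at this
  linarith

/-- The sum of a logarithmic potential that is harmonic near `z₀` and a positive multiple of
`‖z‖ ^ 2` has no local maximum at `z₀`. -/
theorem exists_lt_of_log_potential {ι : Type*} [Fintype ι] {a : ι → ℝ} (hF : IsCompact F)
    (hσ : σ Fᶜ = 0) {z₀ : ℂ} {d η : ℝ} (hη0 : 0 < η) (hd : 0 < d)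
    (hdF : ∀ t ∈ F, d ≤ ‖z₀ - (t : ℂ)‖) (hda : ∀ i, d ≤ ‖z₀ - a i‖) :
    ∃ v : ℂ, ‖v‖ < d ∧
      ∑ i, Real.log ‖z₀ - a i‖ - Fintype.card ι * ∫ t : ℝ, Real.log ‖z₀ - t‖ ∂σ + η * ‖z₀‖ ^ 2 <
        ∑ i, Real.log ‖z₀ + v - a i‖ - Fintype.card ι * ∫ t : ℝ, Real.log ‖z₀ + v - t‖ ∂σ +
          η * ‖z₀ + v‖ ^ 2 := by
  by_contra! hcmp
  set n : ℝ := ((Fintype.card ι : ℕ) : ℝ) with hn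
  have hn0 : 0 ≤ n := Nat.cast_nonneg _
  -- The sum and the integral each lose at most `2 * n * h ^ 4 / d ^ 4`, while the quadratic term
  -- gains `4 * η * h ^ 2`. The condition on `h` makes the gain larger.
  obtain ⟨h, hhd, hhη, hh⟩ : ∃ h : ℝ, h < d / 2 ∧ n * h ^ 2 < η * d ^ 4 ∧ 0 < h := by
    have h1 : ∀ᶠ h : ℝ in 𝓝[>] 0, h < d / 2 :=
      nhdsWithin_le_nhds (eventually_lt_nhds (by positivity))
    have h2 : ∀ᶠ h : ℝ in 𝓝[>] 0, n * h ^ 2 < η * d ^ 4 := by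
      refine nhdsWithin_le_nhds (ContinuousAt.eventually_lt (by fun_prop) continuousAt_const ?_)
      simp only [ne_eq, OfNat.ofNat_ne_zero, not_false_eq_true, zero_pow, mul_zero]
      positivity
    exact (h1.and (h2.and self_mem_nhdsWithin)).exists
  have e1 : ‖(h : ℂ)‖ = h := by rw [Complex.norm_real, Real.norm_eq_abs, abs_of_pos hh]
  have e2 : ‖(h : ℂ) * Complex.I‖ = h := by rw [norm_mul, Complex.norm_I, e1, mul_one]
  have c1 := hcmp h (by linarith)
  have c2 := hcmp (-h) (by rw [norm_neg, e1]; linarith)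
  have c3 := hcmp (h * Complex.I) (by linarith)
  have c4 := hcmp (-(h * Complex.I)) (by rw [norm_neg, e2]; linarith)
  simp only [← sub_eq_add_neg] at c2 c4
  have k1 : 4 * ∑ i, Real.log ‖z₀ - a i‖ - n * (2 * h ^ 4 / d ^ 4) ≤
      crossSum (fun z => ∑ i, Real.log ‖z - a i‖) z₀ h := by
    have : crossSum (fun z => ∑ i, Real.log ‖z - a i‖) z₀ h =
        ∑ i, crossSum (fun z => Real.log ‖z - a i‖) z₀ h := by
      simp only [crossSum, Finset.sum_add_distrib]
    rw [this, Finset.mul_sum, hn, ← nsmul_eq_mul, ← Finset.card_univ, ← Finset.sum_const,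
      ← Finset.sum_sub_distrib]
    refine Finset.sum_le_sum fun i _ => ?_
    have := (abs_le.1 (abs_crossSum_log_norm_sub_le hh (by linarith : 2 * h ≤ d)
      (hda i))).1
    linarith
  have k2 := le_crossSum_integral_log_norm_sub hF hσ hh (by linarith : 2 * h ≤ d)
    hdF
  have k3 := crossSum_norm_sq z₀ h
  have k4 := mul_le_mul_of_nonneg_left k2 hn0
  have k5 := congrArg (η * ·) k3
  have k6 : crossSum (fun z => ∑ i, Real.log ‖z - a i‖) z₀ h -
      n * crossSum (fun z : ℂ => ∫ t : ℝ, Real.log ‖z - t‖ ∂σ) z₀ h +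
        η * crossSum (fun z => ‖z‖ ^ 2) z₀ h ≤
      4 * (∑ i, Real.log ‖z₀ - a i‖ - n * ∫ t : ℝ, Real.log ‖z₀ - t‖ ∂σ + η * ‖z₀‖ ^ 2) := by
    simp only [crossSum]
    linarith
  have e : 2 * h ^ 4 / d ^ 4 = 2 * (h ^ 4 / d ^ 4) := by ring
  rw [e] at k1 k4
  have k7 : n * (h ^ 4 / d ^ 4) < η * h ^ 2 := by
    rw [← mul_div_assoc, div_lt_iff₀ (by positivity)]
    nlinarith [pow_pos hh 2]
  linarith

/-- A polynomial with real zeros `a i` bounded by `exp (M * deg)` on a compact set `F ⊆ ℝ` is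
bounded off `F` in terms of the logarithmic potential of any probability measure on `F`. -/
theorem sum_log_norm_sub_le {ι : Type*} [Fintype ι] [Nonempty ι] {a : ι → ℝ} (hF : IsCompact F)
    (hσ : σ Fᶜ = 0) {c M : ℝ}
    (hc : ∀ z : ℂ, z ∉ ((↑) : ℝ → ℂ) '' F → -c ≤ ∫ t : ℝ, Real.log ‖z - t‖ ∂σ)
    (hM : ∀ x ∈ F, ∏ i, |x - a i| ≤ Real.exp (Fintype.card ι * M))
    {z₁ : ℂ} (hz₁ : z₁ ∉ ((↑) : ℝ → ℂ) '' F) (hz₁a : ∀ i, z₁ ≠ a i) :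
    ∑ i, Real.log ‖z₁ - a i‖ ≤
      Fintype.card ι * (max (M + c) 0 + ∫ t : ℝ, Real.log ‖z₁ - t‖ ∂σ) := by
  classical
  set n : ℝ := ((Fintype.card ι : ℕ) : ℝ) with hn
  have hn0 : 0 < n := by rw [hn]; exact_mod_cast Fintype.card_pos
  set N := max (M + c) 0 with hN
  have hN0 : 0 ≤ N := le_max_right _ _
  set F' : Set ℂ := ((↑) : ℝ → ℂ) '' F with hF'
  have hF'c : IsCompact F' := hF.image Complex.continuous_ofReal
  set ψ : ℂ → ℝ := fun z => ∫ t : ℝ, Real.log ‖z - t‖ ∂σ with hψ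
  set p : ℂ → ℝ := fun z => ∏ i, ‖z - a i‖ with hp
  have hpc : Continuous p := by fun_prop
  have hp0 : ∀ z, 0 ≤ p z := fun z => Finset.prod_nonneg fun i _ => norm_nonneg _
  have hlogp : ∀ z, p z ≠ 0 → Real.log (p z) = ∑ i, Real.log ‖z - a i‖ := fun z hz =>
    Real.log_prod fun i _ => (Finset.prod_ne_zero_iff.1 hz) i (Finset.mem_univ i)
  have hp1 : p z₁ ≠ 0 := Finset.prod_ne_zero_iff.2 fun i _ =>
    norm_ne_zero_iff.2 (sub_ne_zero.2 (hz₁a i))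
  by_contra hcon
  set u₁ := ∑ i, Real.log ‖z₁ - a i‖ - n * ψ z₁ with hu₁
  have hu : n * N < u₁ := by
    rw [hu₁]; push Not at hcon; linarith [mul_add n N (ψ z₁)]
  have hu0 : 0 < u₁ := lt_of_le_of_lt (by positivity) hu
  -- a disc that contains everything
  obtain ⟨R₀, hR₀⟩ := (hF.isBounded.union (Set.finite_range a).isBounded).exists_norm_le
  set R := max R₀ 0 with hR
  have hR0 : 0 ≤ R := le_max_right _ _
  have hFR : ∀ t ∈ F, ‖(t : ℂ)‖ ≤ R := fun t ht => by
    rw [Complex.norm_real]; exact (hR₀ t (Or.inl ht)).trans (le_max_left _ _)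
  have haR : ∀ i, ‖(a i : ℂ)‖ ≤ R := fun i => by
    rw [Complex.norm_real]; exact (hR₀ _ (Or.inr ⟨i, rfl⟩)).trans (le_max_left _ _)
  -- On the circle of radius `R'` the function `∑ log ‖z - a i‖ - n ψ` is at most `n log ((R' + R) /
  -- (R' - R))`. The last summand of `R'` brings this below `u₁ / 2`.
  set R' := R + ‖z₁‖ + 1 + 4 * n * R / u₁ with hR'
  have h4 : 0 ≤ 4 * n * R / u₁ := by positivity
  have hz₁R : ‖z₁‖ ≤ R' := by linarith
  have hRR' : R < R' := by linarith [norm_nonneg z₁]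
  have hR'0 : 0 < R' := by linarith
  have hlogR : n * (Real.log (R' + R) - Real.log (R' - R)) ≤ u₁ / 2 := by
    have hpos : 0 < R' - R := by linarith
    rw [← Real.log_div (by linarith) hpos.ne']
    have h1 := Real.log_le_sub_one_of_pos (div_pos (by linarith : 0 < R' + R) hpos)
    have h2 : (R' + R) / (R' - R) - 1 = 2 * R / (R' - R) := by field_simp; ring
    have h3 : n * (2 * R / (R' - R)) ≤ u₁ / 2 := by
      rw [← mul_div_assoc, div_le_iff₀ hpos]
      have : u₁ * (4 * n * R / u₁) = 4 * n * R := by field_simp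
      nlinarith [norm_nonneg z₁]
    rw [h2] at h1
    exact (mul_le_mul_of_nonneg_left h1 hn0.le).trans h3
  -- The perturbation `η ‖z‖ ^ 2` on the disc uses at most half of the margin by which `u₁` exceeds
  -- both the bound `n * N` on `F` and the bound `u₁ / 2` on the circle.
  set η := min (u₁ - n * N) (u₁ / 2) / (2 * R' ^ 2) with hη
  have hmin : 0 < min (u₁ - n * N) (u₁ / 2) := lt_min (by linarith) (by linarith)
  have hη0 : 0 < η := by positivity
  have hηR : η * R' ^ 2 = min (u₁ - n * N) (u₁ / 2) / 2 := by rw [hη]; field_simp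
  have hη1 : n * N + η * R' ^ 2 < u₁ := by
    have := min_le_left (u₁ - n * N) (u₁ / 2); linarith
  have hη2 : u₁ / 2 + η * R' ^ 2 < u₁ := by
    have := min_le_right (u₁ - n * N) (u₁ / 2); linarith
  -- the maximum of the perturbed function
  set g : ℂ → ℝ := fun z =>
    p z * Real.exp (-(n * if z ∈ F' then -c else ψ z) + η * ‖z‖ ^ 2) with hg
  have husc : UpperSemicontinuous g := by
    intro z
    by_cases hz : z ∈ F'
    · intro y hy
      have hcont : Continuous fun z : ℂ => p z * Real.exp (-(n * -c) + η * ‖z‖ ^ 2) := by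
        fun_prop
      have hgz : g z = p z * Real.exp (-(n * -c) + η * ‖z‖ ^ 2) := by simp only [hg, if_pos hz]
      rw [hgz] at hy
      filter_upwards [hcont.continuousAt.eventually_lt continuousAt_const hy] with z' hz'
      refine lt_of_le_of_lt ?_ hz'
      refine mul_le_mul_of_nonneg_left (Real.exp_le_exp.2 ?_) (hp0 z')
      have : -c ≤ if z' ∈ F' then -c else ψ z' := by
        split_ifs with h
        · exact le_rfl
        · exact hc z' h
      nlinarith
    · refine ContinuousAt.upperSemicontinuousAt ?_
      have hev : (fun z => p z * Real.exp (-(n * ψ z) + η * ‖z‖ ^ 2)) =ᶠ[𝓝 z] g := by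
        filter_upwards [hF'c.isClosed.isOpen_compl.mem_nhds hz] with z' hz'
        simp only [hg, if_neg (show z' ∉ F' from hz')]
      refine ContinuousAt.congr ?_ hev
      have hψc : ContinuousAt ψ z := continuousAt_integral_log_norm_sub hF hσ hz
      exact hpc.continuousAt.mul (((hψc.const_mul n).neg.add (by fun_prop)).rexp)
  obtain ⟨z₀, hz₀, hmax⟩ := (husc.upperSemicontinuousOn (Metric.closedBall (0 : ℂ) R')).exists_isMaxOn
    ⟨z₁, by simpa using hz₁R⟩ (isCompact_closedBall _ _)
  have hz₀R : ‖z₀‖ ≤ R' := by simpa using hz₀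
  have hg1 : Real.exp u₁ ≤ g z₀ := by
    refine le_trans ?_ (hmax (show z₁ ∈ Metric.closedBall (0 : ℂ) R' by simpa using hz₁R))
    simp only [hg, if_neg hz₁]
    rw [← Real.exp_log (lt_of_le_of_ne (hp0 z₁) hp1.symm), ← Real.exp_add, hlogp z₁ hp1]
    refine Real.exp_le_exp.2 ?_
    have : 0 ≤ η * ‖z₁‖ ^ 2 := by positivity
    linarith
  have hηz : η * ‖z₀‖ ^ 2 ≤ η * R' ^ 2 := by gcongr
  by_cases hzF : z₀ ∈ F'
  · obtain ⟨x, hx, hxz⟩ := hzF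
    have hzF : z₀ ∈ F' := ⟨x, hx, hxz⟩
    have hpx : p z₀ ≤ Real.exp (n * M) := by
      refine le_trans (le_of_eq ?_) (hM x hx)
      simp only [hp, ← hxz]
      refine Finset.prod_congr rfl fun i _ => ?_
      rw [← Complex.ofReal_sub, Complex.norm_real, Real.norm_eq_abs]
    have h1 : g z₀ < Real.exp u₁ := by
      simp only [hg, if_pos hzF]
      refine (mul_le_mul_of_nonneg_right hpx (Real.exp_pos _).le).trans_lt ?_
      rw [← Real.exp_add]
      refine Real.exp_lt_exp.2 ?_
      have : n * (M + c) ≤ n * N := mul_le_mul_of_nonneg_left (le_max_left _ _) hn0.le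
      linarith [mul_add n M c]
    linarith
  have hgz : g z₀ = p z₀ * Real.exp (-(n * ψ z₀) + η * ‖z₀‖ ^ 2) := by simp only [hg, if_neg hzF]
  have hpz : p z₀ ≠ 0 := by
    intro h0
    rw [hgz, h0, zero_mul] at hg1
    linarith [Real.exp_pos u₁]
  rcases hz₀R.eq_or_lt with hbd | hint
  · have hpR : p z₀ ≤ Real.exp (n * Real.log (R' + R)) := by
      rw [← Real.log_le_iff_le_exp (lt_of_le_of_ne (hp0 _) hpz.symm), hlogp _ hpz, hn,
        ← nsmul_eq_mul, ← Finset.card_univ]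
      refine Finset.sum_le_card_nsmul _ _ _ fun i _ => ?_
      refine Real.log_le_log (lt_of_le_of_ne (norm_nonneg _) (Ne.symm
        (Finset.prod_ne_zero_iff.1 hpz i (Finset.mem_univ i)))) ?_
      exact (norm_sub_le _ _).trans (add_le_add hbd.le (haR i))
    have hψR : Real.log (R' - R) ≤ ψ z₀ := by
      have hFae : ∀ᵐ t ∂σ, t ∈ F := hσ
      have : Real.log (R' - R) = ∫ _ : ℝ, Real.log (R' - R) ∂σ := by simp
      rw [this]
      refine integral_mono_ae (integrable_const _) (integrable_log_norm_sub hF hσ hzF) ?_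
      filter_upwards [hFae] with t ht
      refine Real.log_le_log (by linarith) ?_
      have := norm_sub_norm_le z₀ (t : ℂ)
      linarith [hFR t ht]
    have h1 : g z₀ < Real.exp u₁ := by
      rw [hgz]
      refine (mul_le_mul_of_nonneg_right hpR (Real.exp_pos _).le).trans_lt ?_
      rw [← Real.exp_add]
      refine Real.exp_lt_exp.2 ?_
      have := mul_le_mul_of_nonneg_left hψR hn0.le
      linarith
    linarith
  -- an interior maximum contradicts the discrete mean value property
  set T : Set ℂ := F' ∪ Set.range fun i => (a i : ℂ) with hT
  have hTc : IsClosed T := hF'c.isClosed.union (Set.finite_range _).isClosed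
  have hzT : z₀ ∈ Tᶜ ∩ Metric.ball 0 R' := by
    refine ⟨?_, by simpa using hint⟩
    rintro (h | ⟨i, hi⟩)
    · exact hzF h
    · refine Finset.prod_ne_zero_iff.1 hpz i (Finset.mem_univ i) ?_
      rw [← hi]; simp
  obtain ⟨d, hd, hball⟩ := Metric.mem_nhds_iff.1
    ((hTc.isOpen_compl.inter Metric.isOpen_ball).mem_nhds hzT)
  have hdT : ∀ t ∈ T, d ≤ ‖z₀ - t‖ := by
    intro t ht
    by_contra h
    refine (hball (show t ∈ Metric.ball z₀ d from ?_)).1 ht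
    rw [Metric.mem_ball, dist_comm, dist_eq_norm]
    exact not_le.1 h
  obtain ⟨v, hv, hlt⟩ := exists_lt_of_log_potential hF hσ hη0 hd
    (fun t ht => hdT _ (Or.inl ⟨t, ht, rfl⟩)) fun i => hdT _ (Or.inr ⟨i, rfl⟩)
  suffices ∑ i, Real.log ‖z₀ + v - a i‖ - n * ψ (z₀ + v) + η * ‖z₀ + v‖ ^ 2 ≤
      ∑ i, Real.log ‖z₀ - a i‖ - n * ψ z₀ + η * ‖z₀‖ ^ 2 from absurd hlt (not_lt.2 this)
  have hmem : z₀ + v ∈ Metric.ball z₀ d := by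
    rw [Metric.mem_ball, dist_eq_norm, add_sub_cancel_left]; exact hv
  have hb := hball hmem
  have hF0 : z₀ + v ∉ F' := fun h => hb.1 (Or.inl h)
  have hpv : p (z₀ + v) ≠ 0 := Finset.prod_ne_zero_iff.2 fun i _ => by
    rw [norm_ne_zero_iff, sub_ne_zero]
    exact fun h => hb.1 (Or.inr ⟨i, h.symm⟩)
  have h1 : g (z₀ + v) ≤ g z₀ := hmax (Metric.ball_subset_closedBall hb.2)
  rw [hgz] at h1
  simp only [hg, if_neg hF0] at h1
  have h2 := Real.log_le_log
    (mul_pos (lt_of_le_of_ne (hp0 _) hpv.symm) (Real.exp_pos _)) h1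
  rw [Real.log_mul hpv (Real.exp_ne_zero _), Real.log_mul hpz (Real.exp_ne_zero _),
    Real.log_exp, Real.log_exp, hlogp _ hpv, hlogp _ hpz] at h2
  linarith

end BernsteinWalsh

/-! ### Existence of equilibrium measures -/

section Existence

theorem continuous_logKernel {X : Type*} [MetricSpace X] :
    Continuous fun p : X × X => logKernel p.1 p.2 :=
  ENNReal.continuous_log.comp (continuous_inv.comp continuous_edist)

section CompactSpace

variable {Y : Type*} [TopologicalSpace Y] [CompactSpace Y] [MeasurableSpace Y]
  [OpensMeasurableSpace Y]

theorem continuous_lintegral_probabilityMeasure {g : Y → ℝ≥0∞} (hg : Continuous g)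
    (hfin : ∀ y, g y ≠ ⊤) : Continuous fun m : ProbabilityMeasure Y => ∫⁻ y, g y ∂(m : Measure Y) := by
  have hc : Continuous fun y => (g y).toNNReal :=
    continuous_iff_continuousAt.2 fun y =>
      (ENNReal.tendsto_toNNReal (hfin y)).comp hg.continuousAt
  simp_rw [continuous_iff_continuousAt, ContinuousAt]
  intro m
  have := ProbabilityMeasure.tendsto_iff_forall_lintegral_tendsto.1 (tendsto_id (x := 𝓝 m))
    (BoundedContinuousFunction.mkOfCompact ⟨_, hc⟩)
  simpa [ENNReal.coe_toNNReal (hfin _)] using this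

/-- By monotone convergence the integral is the supremum of the integrals of the bounded truncations
`min g k`, each weakly continuous in the measure. -/
theorem lowerSemicontinuous_lintegral_probabilityMeasure {g : Y → ℝ≥0∞} (hg : Continuous g) :
    LowerSemicontinuous fun m : ProbabilityMeasure Y => ∫⁻ y, g y ∂(m : Measure Y) := by
  have he : ∀ m : ProbabilityMeasure Y, ∫⁻ y, g y ∂(m : Measure Y) =
      ⨆ k : ℕ, ∫⁻ y, min (g y) k ∂(m : Measure Y) := by
    intro m
    rw [← lintegral_iSup (fun k => (hg.min continuous_const).measurable)
      (fun i j hij y => min_le_min_left _ (by exact_mod_cast hij))]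
    refine lintegral_congr fun y => ?_
    rw [← inf_iSup_eq, ENNReal.iSup_natCast, inf_top_eq]
  simp_rw [he]
  refine lowerSemicontinuous_iSup fun k => ?_
  exact (continuous_lintegral_probabilityMeasure (hg.min continuous_const) fun y =>
    ne_top_of_le_ne_top (ENNReal.natCast_ne_top k) (min_le_right _ _)).lowerSemicontinuous

end CompactSpace

/-- The positive part of the kernel contributes a lower semicontinuous term. The negative part is
continuous and bounded on the compact product, so its integral is finite and weakly continuous. -/
theorem lowerSemicontinuous_logEnergy {K : Type*} [MetricSpace K] [CompactSpace K]
    [MeasurableSpace K] [BorelSpace K] :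
    LowerSemicontinuous fun m : ProbabilityMeasure K => logEnergy (m : Measure K) := by
  have hprod : Continuous fun m : ProbabilityMeasure K => m.prod m :=
    ProbabilityMeasure.continuous_prod.comp (continuous_id.prodMk continuous_id)
  have hk := continuous_logKernel (X := K)
  have hpos : LowerSemicontinuous fun m : ProbabilityMeasure K =>
      ((∫⁻ p, (logKernel p.1 p.2).toENNReal ∂((m : Measure K).prod m) : ℝ≥0∞) : EReal) :=
    continuous_coe_ennreal_ereal.comp_lowerSemicontinuous
      ((lowerSemicontinuous_lintegral_probabilityMeasure hk.ereal_toENNReal).comp hprod)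
      EReal.coe_ennreal_strictMono.monotone
  have hne : ∀ p : K × K, (-logKernel p.1 p.2).toENNReal ≠ ⊤ := by
    intro p
    rw [Ne, EReal.toENNReal_eq_top_iff, logKernel, ENNReal.log_inv, neg_neg,
      ENNReal.log_eq_top_iff]
    exact edist_ne_top _ _
  have hnegc : Continuous fun p : K × K => (-logKernel p.1 p.2).toENNReal :=
    Continuous.ereal_toENNReal (continuous_neg.comp hk)
  have hneg : Continuous fun m : ProbabilityMeasure K =>
      ∫⁻ p, (-logKernel p.1 p.2).toENNReal ∂((m : Measure K).prod m) :=
    (continuous_lintegral_probabilityMeasure hnegc hne).comp hprod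
  have hfin : ∀ m : ProbabilityMeasure K,
      ∫⁻ p, (-logKernel p.1 p.2).toENNReal ∂((m : Measure K).prod m) ≠ ⊤ := by
    intro m
    obtain ⟨C, hC⟩ : ∃ C : ℝ≥0∞, C ≠ ⊤ ∧ ∀ p : K × K, (-logKernel p.1 p.2).toENNReal ≤ C := by
      rcases isEmpty_or_nonempty (K × K) with h | h
      · exact ⟨0, by simp, fun p => h.elim p⟩
      · obtain ⟨p, -, hp⟩ := isCompact_univ.exists_isMaxOn Set.univ_nonempty hnegc.continuousOn
        exact ⟨_, hne p, fun q => hp (Set.mem_univ q)⟩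
    refine ne_top_of_le_ne_top hC.1 ((lintegral_mono hC.2).trans ?_)
    simp
  have hsub : LowerSemicontinuous fun m : ProbabilityMeasure K =>
      ((∫⁻ p, (logKernel p.1 p.2).toENNReal ∂((m : Measure K).prod m) : ℝ≥0∞) : EReal) +
      -((∫⁻ p, (-logKernel p.1 p.2).toENNReal ∂((m : Measure K).prod m) : ℝ≥0∞) : EReal) := by
    refine hpos.add' ((continuous_neg.comp
      (continuous_coe_ennreal_ereal.comp hneg)).lowerSemicontinuous) fun m => ?_
    refine EReal.continuousAt_add (Or.inr ?_) (Or.inl ?_)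
    · simpa using hfin m
    · exact EReal.coe_ennreal_ne_bot _
  exact hsub

theorem logEnergy_map_subtype_val {X : Type*} [MetricSpace X] [MeasurableSpace X] [BorelSpace X]
    [SecondCountableTopology X] {E : Set X} (m : Measure E) [SFinite m] :
    logEnergy (m.map Subtype.val) = logEnergy m := by
  have hk := (continuous_logKernel (X := X)).measurable
  have hkn : Measurable fun p : X × X => (-logKernel p.1 p.2).toENNReal :=
    hk.neg.ereal_toENNReal
  have hm : Measurable (Prod.map (Subtype.val : E → X) (Subtype.val : E → X)) :=
    measurable_subtype_coe.prodMap measurable_subtype_coe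
  simp only [logEnergy, eIntegral]
  rw [Measure.map_prod_map _ _ measurable_subtype_coe measurable_subtype_coe,
    lintegral_map hk.ereal_toENNReal hm, lintegral_map hkn hm]
  rfl

/-- A lower semicontinuous energy attains its minimum on the weakly compact space of probability
measures on the subtype `E`. Push-forward and `comap` along the inclusion transfer the minimizer to
`X`. -/
theorem exists_isEquilibriumMeasure {X : Type*} [MetricSpace X] [MeasurableSpace X] [BorelSpace X]
    [SecondCountableTopology X] {E : Set X} (hE : IsCompact E) (hne : E.Nonempty) :
    ∃ ρ, IsEquilibriumMeasure E ρ := by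
  have : CompactSpace E := isCompact_iff_compactSpace.1 hE
  have : Nonempty E := hne.to_subtype
  have hEm : MeasurableSet E := hE.isClosed.measurableSet
  obtain ⟨m, -, hm⟩ := ((lowerSemicontinuous_logEnergy (K := E)).lowerSemicontinuousOn
    Set.univ).exists_isMinOn ⟨⟨Measure.dirac ⟨_, hne.some_mem⟩, inferInstance⟩, Set.mem_univ _⟩ isCompact_univ
  refine ⟨(m : Measure E).map Subtype.val, ⟨?_, ?_⟩, fun ν hν => ?_⟩
  · exact Measure.isProbabilityMeasure_map measurable_subtype_coe.aemeasurable
  · rw [Measure.map_apply measurable_subtype_coe hEm.compl]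
    simp
  · have hprob := hν.1
    have hmap : (ν.comap (Subtype.val : E → X)).map Subtype.val = ν := by
      rw [map_comap_subtype_coe hEm, Measure.restrict_eq_self_of_ae_mem]
      exact hν.2
    have hp : IsProbabilityMeasure (ν.comap (Subtype.val : E → X)) := by
      constructor
      rw [← Set.preimage_univ (f := Subtype.val), ← Measure.map_apply measurable_subtype_coe
        MeasurableSet.univ, hmap, measure_univ]
    rw [← hmap, logEnergy_map_subtype_val, logEnergy_map_subtype_val]
    exact hm (Set.mem_univ (⟨_, hp⟩ : ProbabilityMeasure E))

end Existence

/-! ### The energy as a real integral, and the potential of the equilibrium measure -/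

section RealEnergy

theorem eIntegral_eq_coe_integral {Y : Type*} [MeasurableSpace Y] {τ : Measure Y} {f : Y → EReal}
    {f' : Y → ℝ} (hf' : Integrable f' τ) (h : ∀ᵐ y ∂τ, f y = (f' y : EReal)) :
    eIntegral τ f = ((∫ y, f' y ∂τ : ℝ) : EReal) := by
  have h1 : ∫⁻ y, (f y).toENNReal ∂τ = ∫⁻ y, ENNReal.ofReal (f' y) ∂τ :=
    lintegral_congr_ae (h.mono fun y hy => by simp [hy])
  have h2 : ∫⁻ y, (-f y).toENNReal ∂τ = ∫⁻ y, ENNReal.ofReal (-f' y) ∂τ :=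
    lintegral_congr_ae (h.mono fun y hy => by
      simp only [hy, ← EReal.coe_neg, EReal.real_coe_toENNReal])
  rw [eIntegral, h1, h2, integral_eq_lintegral_pos_part_sub_lintegral_neg_part hf', EReal.coe_sub,
    EReal.coe_ennreal_toReal, EReal.coe_ennreal_toReal]
  · simpa using hf'.neg.lintegral_lt_top.ne
  · exact hf'.lintegral_lt_top.ne

theorem logKernel_real_of_ne {x y : ℝ} (h : x ≠ y) :
    logKernel x y = ((-Real.log |x - y| : ℝ) : EReal) := by
  have h0 : 0 < |x - y| := abs_pos.2 (sub_ne_zero.2 h)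
  rw [logKernel, ENNReal.log_inv, edist_dist, Real.dist_eq, ENNReal.log_ofReal_of_pos h0,
    EReal.coe_neg]

theorem logKernel_self {X : Type*} [MetricSpace X] (x : X) : logKernel x x = ⊤ := by
  simp [logKernel]

theorem measurable_log_abs_sub : Measurable fun p : ℝ × ℝ => Real.log |p.1 - p.2| := by
  fun_prop

theorem logEnergy_eq_coe_integral {ν : Measure ℝ}
    (hi : Integrable (fun p : ℝ × ℝ => Real.log |p.1 - p.2|) (ν.prod ν))
    (hd : ∀ᵐ p ∂(ν.prod ν), p.1 ≠ p.2) :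
    logEnergy ν = ((-∫ p : ℝ × ℝ, Real.log |p.1 - p.2| ∂(ν.prod ν) : ℝ) : EReal) := by
  rw [← integral_neg]
  exact eIntegral_eq_coe_integral hi.neg (hd.mono fun p hp => logKernel_real_of_ne hp)

/-- On a bounded set `log |x - y|` is bounded above, so finite energy forces the positive part of
the kernel to be integrable. The kernel is `⊤` on the diagonal, which must therefore be null. This
is recorded separately because `Real.log 0 = 0` hides the diagonal. -/
theorem integrable_of_logEnergy_ne_top {E : Set ℝ} (hE : IsCompact E) {ν : Measure ℝ}
    (hν : ν ∈ probOn E) (htop : logEnergy ν ≠ ⊤) :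
    Integrable (fun p : ℝ × ℝ => Real.log |p.1 - p.2|) (ν.prod ν) ∧
      ∀ᵐ p ∂(ν.prod ν), p.1 ≠ p.2 := by
  have hprob := hν.1
  have hEae : ∀ᵐ x ∂ν, x ∈ E := hν.2
  have hEE : ∀ᵐ p ∂(ν.prod ν), p.1 ∈ E ∧ p.2 ∈ E := by
    have h1 : ∀ᵐ p ∂(ν.prod ν), p.1 ∈ E := Measure.quasiMeasurePreserving_fst.ae hEae
    have h2 : ∀ᵐ p ∂(ν.prod ν), p.2 ∈ E := Measure.quasiMeasurePreserving_snd.ae hEae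
    exact h1.and h2
  obtain ⟨C, hC⟩ := hE.isBounded.exists_norm_le
  have hneg : ∫⁻ p : ℝ × ℝ, (-logKernel p.1 p.2).toENNReal ∂(ν.prod ν) ≠ ⊤ := by
    refine ne_top_of_le_ne_top (b := ENNReal.ofReal (2 * C)) ENNReal.ofReal_ne_top ?_
    have : ∫⁻ _ : ℝ × ℝ, ENNReal.ofReal (2 * C) ∂(ν.prod ν) = ENNReal.ofReal (2 * C) := by simp
    rw [← this]
    refine lintegral_mono_ae (hEE.mono fun p hp => ?_)
    by_cases h : p.1 = p.2
    · rw [h, logKernel_self]; simp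
    · rw [logKernel_real_of_ne h, ← EReal.coe_neg, neg_neg, EReal.real_coe_toENNReal]
      refine ENNReal.ofReal_le_ofReal ((Real.log_le_self (abs_nonneg _)).trans ?_)
      have h1 := abs_sub p.1 p.2
      have h2 := hC _ hp.1
      have h3 := hC _ hp.2
      rw [Real.norm_eq_abs] at h2 h3
      linarith
  have hpos : ∫⁻ p : ℝ × ℝ, (logKernel p.1 p.2).toENNReal ∂(ν.prod ν) ≠ ⊤ := by
    intro h
    refine htop ?_
    rw [logEnergy, eIntegral, h, EReal.coe_ennreal_top]
    rw [sub_eq_add_neg, EReal.top_add_of_ne_bot (by simpa using hneg)]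
  have hkm := (continuous_logKernel (X := ℝ)).measurable
  have hd : ∀ᵐ p ∂(ν.prod ν), p.1 ≠ p.2 := by
    filter_upwards [ae_lt_top hkm.ereal_toENNReal hpos] with p hp h
    rw [h, logKernel_self] at hp
    simp at hp
  refine ⟨⟨measurable_log_abs_sub.aestronglyMeasurable, ?_⟩, hd⟩
  have hle : ∫⁻ p : ℝ × ℝ, ‖Real.log |p.1 - p.2|‖ₑ ∂(ν.prod ν) ≤
      ∫⁻ p : ℝ × ℝ, (logKernel p.1 p.2).toENNReal ∂(ν.prod ν) +
        ∫⁻ p : ℝ × ℝ, (-logKernel p.1 p.2).toENNReal ∂(ν.prod ν) := by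
    rw [← lintegral_add_left hkm.ereal_toENNReal]
    refine lintegral_mono_ae (hd.mono fun p hp => ?_)
    rw [logKernel_real_of_ne hp, ← EReal.coe_neg, neg_neg, EReal.real_coe_toENNReal,
      EReal.real_coe_toENNReal, Real.enorm_eq_ofReal_abs]
    rcases le_total 0 (Real.log |p.1 - p.2|) with h | h
    · rw [abs_of_nonneg h]; exact le_add_self
    · rw [abs_of_nonpos h]; exact le_self_add
  exact hle.trans_lt (ENNReal.add_lt_top.2 ⟨hpos.lt_top, hneg.lt_top⟩)

/-- The first variation of the energy at an equilibrium measure vanishes. -/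
theorem IsEquilibriumMeasure.integral_mul_log_eq_zero {E : Set ℝ} {ρ : Measure ℝ}
    (hρ : IsEquilibriumMeasure E ρ)
    (hi : Integrable (fun p : ℝ × ℝ => Real.log |p.1 - p.2|) (ρ.prod ρ))
    (hd : ∀ᵐ p ∂(ρ.prod ρ), p.1 ≠ p.2) {h : ℝ → ℝ} (hm : Measurable h) (hb : ∀ x, |h x| ≤ 1)
    (h0 : ∫ x, h x ∂ρ = 0) :
    ∫ p : ℝ × ℝ, (h p.1 + h p.2) * Real.log |p.1 - p.2| ∂(ρ.prod ρ) = 0 := by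
  have hprob := hρ.1.1
  set k : ℝ × ℝ → ℝ := fun p => Real.log |p.1 - p.2| with hk
  have hb1 : ∀ p : ℝ × ℝ, ‖h p.1 + h p.2‖ ≤ 2 := fun p =>
    (abs_add_le _ _).trans (by linarith [hb p.1, hb p.2])
  have hb2 : ∀ p : ℝ × ℝ, ‖h p.1 * h p.2‖ ≤ 1 := fun p => by
    rw [Real.norm_eq_abs, abs_mul]
    exact mul_le_one₀ (hb _) (abs_nonneg _) (hb _)
  have hi1 : Integrable (fun p : ℝ × ℝ => (h p.1 + h p.2) * k p) (ρ.prod ρ) :=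
    hi.bdd_mul (Measurable.aestronglyMeasurable (by fun_prop)) (ae_of_all _ hb1)
  have hi2 : Integrable (fun p : ℝ × ℝ => (h p.1 * h p.2) * k p) (ρ.prod ρ) :=
    hi.bdd_mul (Measurable.aestronglyMeasurable (by fun_prop)) (ae_of_all _ hb2)
  set A := ∫ p : ℝ × ℝ, (h p.1 + h p.2) * k p ∂(ρ.prod ρ) with hA
  set B := ∫ p : ℝ × ℝ, (h p.1 * h p.2) * k p ∂(ρ.prod ρ) with hB
  have hih : Integrable h ρ :=
    Integrable.of_bound hm.aestronglyMeasurable 1 (ae_of_all _ hb)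
  -- The competitors are the probability measures `(1 + t h) ρ`, along which the logarithmic
  -- integral is a quadratic polynomial in `t`.
  have key : ∀ t : ℝ, |t| ≤ 1 → t * A + t ^ 2 * B ≤ 0 := by
    intro t ht
    have hw : ∀ x, 0 ≤ 1 + t * h x := fun x => by
      have : |t * h x| ≤ 1 := by
        rw [abs_mul]; exact mul_le_one₀ ht (abs_nonneg _) (hb x)
      linarith [(abs_le.1 this).1]
    set w : ℝ → ℝ≥0∞ := fun x => ENNReal.ofReal (1 + t * h x) with hwdef
    have hwm : Measurable w := by fun_prop
    have hwi : Integrable (fun x => 1 + t * h x) ρ := (integrable_const _).add (hih.const_mul t)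
    set ν := ρ.withDensity w with hν
    have hνprob : ν ∈ probOn E := by
      refine ⟨⟨?_⟩, withDensity_absolutelyContinuous _ _ hρ.1.2⟩
      rw [hν, withDensity_apply _ MeasurableSet.univ, Measure.restrict_univ,
        ← ofReal_integral_eq_lintegral_ofReal hwi (ae_of_all _ hw),
        integral_add (integrable_const _) (hih.const_mul t), integral_const_mul, h0]
      simp
    have hprod : ν.prod ν = (ρ.prod ρ).withDensity fun p => w p.1 * w p.2 :=
      have := hνprob.1
      prod_withDensity hwm hwm
    have hWm : Measurable fun p : ℝ × ℝ => w p.1 * w p.2 := by fun_prop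
    have hWfin : ∀ᵐ p ∂(ρ.prod ρ), w p.1 * w p.2 < ∞ :=
      ae_of_all _ fun p => ENNReal.mul_lt_top ENNReal.ofReal_lt_top ENNReal.ofReal_lt_top
    have hexp : ∀ p : ℝ × ℝ, (w p.1 * w p.2).toReal • k p =
        k p + t * ((h p.1 + h p.2) * k p) + t ^ 2 * ((h p.1 * h p.2) * k p) := by
      intro p
      rw [ENNReal.toReal_mul, ENNReal.toReal_ofReal (hw _), ENNReal.toReal_ofReal (hw _),
        smul_eq_mul]
      ring
    have hi12 : Integrable (fun p : ℝ × ℝ => k p + t * ((h p.1 + h p.2) * k p)) (ρ.prod ρ) :=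
      hi.add (hi1.const_mul t)
    have hνi : Integrable k (ν.prod ν) := by
      rw [hprod, integrable_withDensity_iff_integrable_smul' hWm hWfin]
      simp only [hexp]
      exact hi12.add (hi2.const_mul _)
    have hνd : ∀ᵐ p ∂(ν.prod ν), p.1 ≠ p.2 := by
      rw [hprod]
      exact (withDensity_absolutelyContinuous _ _).ae_le hd
    have hval : ∫ p, k p ∂(ν.prod ν) = ∫ p, k p ∂(ρ.prod ρ) + t * A + t ^ 2 * B := by
      rw [hprod, integral_withDensity_eq_integral_toReal_smul hWm hWfin]
      simp only [hexp]
      rw [integral_add hi12 (hi2.const_mul _), integral_add hi (hi1.const_mul t),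
        integral_const_mul, integral_const_mul]
    have hle := hρ.2 ν hνprob
    rw [logEnergy_eq_coe_integral hi hd, logEnergy_eq_coe_integral hνi hνd, EReal.coe_le_coe_iff,
      neg_le_neg_iff, hval] at hle
    linarith
  by_contra hne
  have hA2 : 0 < A ^ 2 := by positivity
  -- This `t` has the sign of `A` and is small enough that the linear term dominates `t ^ 2 * B`.
  set t := A / (A ^ 2 + |A| + |B| + 1) with ht
  have hD : 0 < A ^ 2 + |A| + |B| + 1 := by positivity
  have ht1 : |t| ≤ 1 := by
    rw [ht, abs_div, abs_of_pos hD, div_le_one hD]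
    linarith [abs_nonneg B]
  have h1 := key t ht1
  have h2 : t * A + t ^ 2 * B =
      A ^ 2 * (A ^ 2 + |A| + |B| + 1 + B) / (A ^ 2 + |A| + |B| + 1) ^ 2 := by
    rw [ht]; field_simp
  rw [h2] at h1
  have h3 : 0 < A ^ 2 + |A| + |B| + 1 + B := by
    linarith [neg_abs_le B, abs_nonneg A]
  have : 0 < A ^ 2 * (A ^ 2 + |A| + |B| + 1 + B) / (A ^ 2 + |A| + |B| + 1) ^ 2 := by positivity
  linarith

/-- The logarithmic potential of an equilibrium measure is almost everywhere constant. -/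
theorem IsEquilibriumMeasure.ae_integral_log_eq {E : Set ℝ} {ρ : Measure ℝ}
    (hρ : IsEquilibriumMeasure E ρ)
    (hi : Integrable (fun p : ℝ × ℝ => Real.log |p.1 - p.2|) (ρ.prod ρ))
    (hd : ∀ᵐ p ∂(ρ.prod ρ), p.1 ≠ p.2) :
    ∀ᵐ x ∂ρ, ∫ y, Real.log |x - y| ∂ρ = ∫ p : ℝ × ℝ, Real.log |p.1 - p.2| ∂(ρ.prod ρ) := by
  have hprob := hρ.1.1
  set L := ∫ p : ℝ × ℝ, Real.log |p.1 - p.2| ∂(ρ.prod ρ) with hL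
  set U : ℝ → ℝ := fun x => ∫ y, Real.log |x - y| ∂ρ with hU
  have hUm : Measurable U :=
    (measurable_log_abs_sub.stronglyMeasurable.integral_prod_right (ν := ρ)).measurable
  have hUi : Integrable U ρ := hi.integral_prod_left
  have hUL : ∫ x, U x ∂ρ = L := (integral_prod _ hi).symm
  -- The test function is the sign of `U - L`, centred to have mean zero and halved to stay bounded
  -- by `1`. Testing against it gives `∫ |U - L| dρ = 0`, because `U - L` itself has mean zero.
  set s : ℝ → ℝ := fun x => if 0 ≤ U x - L then 1 else -1 with hs
  have hsm : Measurable s :=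
    Measurable.ite (measurableSet_le measurable_const (hUm.sub_const L)) measurable_const
      measurable_const
  have hsb : ∀ x, |s x| ≤ 1 := fun x => by simp only [hs]; split_ifs <;> simp
  have hsi : Integrable s ρ := Integrable.of_bound hsm.aestronglyMeasurable 1 (ae_of_all _ hsb)
  set a := ∫ x, s x ∂ρ with ha
  have hab : |a| ≤ 1 := by
    have := abs_integral_le_of_measure_compl (ν := ρ) (K := Set.univ) (by simp)
      (fun x _ => hsb x)
    simpa using this
  set h : ℝ → ℝ := fun x => (s x - a) / 2 with hh
  have hhm : Measurable h := (hsm.sub_const a).div_const 2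
  have hhb : ∀ x, |h x| ≤ 1 := fun x => by
    have := abs_sub (s x) a
    simp only [hh]
    rw [abs_div, abs_two, div_le_one two_pos]
    linarith [hsb x]
  have hh0 : ∫ x, h x ∂ρ = 0 := by
    simp only [hh]
    rw [integral_div, integral_sub hsi (integrable_const a)]
    simp [ha]
  have hvar := hρ.integral_mul_log_eq_zero hi hd hhm hhb hh0
  have hi1 : Integrable (fun p : ℝ × ℝ => h p.1 * Real.log |p.1 - p.2|) (ρ.prod ρ) :=
    hi.bdd_mul (Measurable.aestronglyMeasurable (by fun_prop)) (ae_of_all _ fun p => hhb p.1)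
  have hi2 : Integrable (fun p : ℝ × ℝ => h p.2 * Real.log |p.1 - p.2|) (ρ.prod ρ) :=
    hi.bdd_mul (Measurable.aestronglyMeasurable (by fun_prop)) (ae_of_all _ fun p => hhb p.2)
  have e1 : ∫ p : ℝ × ℝ, h p.1 * Real.log |p.1 - p.2| ∂(ρ.prod ρ) = ∫ x, h x * U x ∂ρ := by
    rw [integral_prod _ hi1]
    simp only [integral_const_mul, hU]
  have e2 : ∫ p : ℝ × ℝ, h p.2 * Real.log |p.1 - p.2| ∂(ρ.prod ρ) = ∫ x, h x * U x ∂ρ := by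
    rw [← e1, ← integral_prod_swap]
    simp only [Prod.fst_swap, Prod.snd_swap, abs_sub_comm]
  simp only [add_mul] at hvar
  rw [integral_add hi1 hi2, e1, e2] at hvar
  have hhU : ∫ x, h x * U x ∂ρ = 0 := by linarith
  have hhUi : Integrable (fun x => h x * U x) ρ :=
    hUi.bdd_mul hhm.aestronglyMeasurable (ae_of_all _ hhb)
  have habs : ∀ x, |U x - L| = 2 * (h x * U x) + a * (U x - L) - 2 * L * h x := by
    intro x
    have : |U x - L| = s x * (U x - L) := by
      simp only [hs]
      split_ifs with h
      · rw [abs_of_nonneg h, one_mul]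
      · rw [abs_of_neg (not_le.1 h)]; ring
    rw [this]
    simp only [hh]
    ring
  have hhi : Integrable h ρ := Integrable.of_bound hhm.aestronglyMeasurable 1 (ae_of_all _ hhb)
  have hULi : Integrable (fun x => U x - L) ρ := hUi.sub (integrable_const L)
  have hzero : ∫ x, |U x - L| ∂ρ = 0 := by
    simp only [habs]
    have i12 : Integrable (fun x => 2 * (h x * U x) + a * (U x - L)) ρ :=
      (hhUi.const_mul 2).add (hULi.const_mul a)
    rw [integral_sub i12 (hhi.const_mul _), integral_add (hhUi.const_mul 2) (hULi.const_mul a),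
      integral_const_mul, integral_const_mul, integral_const_mul, hhU, hh0,
      integral_sub hUi (integrable_const L), hUL]
    simp
  rw [integral_eq_zero_iff_of_nonneg (fun x => abs_nonneg _) hULi.abs] at hzero
  filter_upwards [hzero] with x hx
  have : |U x - L| = 0 := hx
  exact sub_eq_zero.1 (abs_eq_zero.1 this)

theorem IsEquilibriumMeasure.logCapacity_eq {E : Set ℝ} {ρ : Measure ℝ}
    (hρ : IsEquilibriumMeasure E ρ) : logCapacity E = (EReal.exp (-logEnergy ρ)).toReal := by
  have : ⨅ ν ∈ probOn E, logEnergy ν = logEnergy ρ :=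
    le_antisymm (iInf₂_le ρ hρ.1) (le_iInf₂ hρ.2)
  rw [logCapacity, this]

end RealEnergy

/-! ### Uniform upper bounds on sets of almost full measure -/

section UniformBounds

theorem measure_lt_norm_le {X : Type*} [MeasurableSpace X] {μ : Measure X} {f : X → ℝ}
    (hf : AEStronglyMeasurable f μ) {r s : ℝ} (hs : eLpNorm f 2 μ ≤ ENNReal.ofReal (Real.exp s)) :
    μ {x | Real.exp r < |f x|} ≤ ENNReal.ofReal (Real.exp (2 * (s - r))) := by
  have h := meas_ge_le_mul_pow_eLpNorm_enorm μ two_ne_zero ENNReal.ofNat_ne_top hf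
    (ε := ENNReal.ofReal (Real.exp r)) (by simpa using Real.exp_pos r) (by simp)
  refine (measure_mono fun x hx => ?_).trans (h.trans ?_)
  · simp only [Set.mem_ofPred_eq, Real.enorm_eq_ofReal_abs] at hx ⊢
    exact ENNReal.ofReal_le_ofReal hx.le
  · rw [← ENNReal.ofReal_inv_of_pos (Real.exp_pos r), ← Real.exp_neg, ← ENNReal.mul_rpow_of_nonneg _ _
      (by simp)]
    refine (ENNReal.rpow_le_rpow (mul_le_mul_right hs _) (by simp)).trans_eq ?_
    rw [← ENNReal.ofReal_mul (Real.exp_pos _).le, ← Real.exp_add,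
      ENNReal.ofReal_rpow_of_pos (Real.exp_pos _), ← Real.exp_mul]
    congr 2
    simp
    ring

/-- The norms are eventually below `exp (n (L + ε / 2))`, so Chebyshev bounds the exceptional sets
by `exp (-n ε)`. Since `j ≤ n j`, these measures are summable and Borel-Cantelli applies. -/
theorem ae_eventually_abs_le {X : Type*} [MeasurableSpace X] {μ : Measure X} {f : ℕ → X → ℝ}
    (hf : ∀ j, AEStronglyMeasurable (f j) μ) (hfin : ∀ j, eLpNorm (f j) 2 μ ≠ ⊤) {n : ℕ → ℕ}
    (hn : StrictMono n) (hn0 : ∀ j, 0 < n j) {L : ℝ}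
    (hlim : Tendsto (fun j => (eLpNorm (f j) 2 μ).toReal ^ (1 / (n j : ℝ))) atTop
      (𝓝 (Real.exp L))) {ε : ℝ} (hε : 0 < ε) :
    ∀ᵐ x ∂μ, ∀ᶠ j in atTop, |f j x| ≤ Real.exp (n j * (L + ε)) := by
  have hev : ∀ᶠ j in atTop, (eLpNorm (f j) 2 μ).toReal ^ (1 / (n j : ℝ)) < Real.exp (L + ε / 2) :=
    hlim.eventually_lt_const (Real.exp_lt_exp.2 (by linarith))
  obtain ⟨N, hN⟩ := eventually_atTop.1 hev
  have hbound : ∀ j ≥ N, μ {x | Real.exp (n j * (L + ε)) < |f j x|} ≤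
      ENNReal.ofReal (Real.exp (-ε)) ^ j := by
    intro j hj
    have hnj : (0 : ℝ) < n j := by exact_mod_cast hn0 j
    have h1 : (eLpNorm (f j) 2 μ).toReal ≤ Real.exp (n j * (L + ε / 2)) := by
      have := Real.rpow_le_rpow (by positivity) (hN j hj).le hnj.le
      rwa [← Real.rpow_mul ENNReal.toReal_nonneg, one_div_mul_cancel hnj.ne', Real.rpow_one,
        ← Real.exp_mul, mul_comm] at this
    refine (measure_lt_norm_le (hf j) (ENNReal.le_ofReal_iff_toReal_le (hfin j)
      (Real.exp_pos _).le |>.2 h1)).trans ?_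
    rw [← ENNReal.ofReal_pow (Real.exp_pos _).le, ← Real.exp_nat_mul]
    refine ENNReal.ofReal_le_ofReal (Real.exp_le_exp.2 ?_)
    have : (j : ℝ) ≤ n j := by exact_mod_cast hn.le_apply
    nlinarith
  have hsum : ∑' j, μ {x | Real.exp (n (j + N) * (L + ε)) < |f (j + N) x|} ≠ ∞ := by
    have hr : ENNReal.ofReal (Real.exp (-ε)) < 1 := by
      rw [ENNReal.ofReal_lt_one, Real.exp_lt_one_iff]
      linarith
    refine ne_top_of_le_ne_top ?_ (ENNReal.tsum_le_tsum fun j =>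
      (hbound (j + N) (by omega)).trans (pow_le_pow_right_of_le_one' hr.le (by omega : j ≤ j + N)))
    rw [ENNReal.tsum_geometric]
    exact ENNReal.inv_ne_top.2 (tsub_pos_of_lt hr).ne'
  filter_upwards [ae_eventually_notMem hsum] with x hx
  obtain ⟨N', hN'⟩ := eventually_atTop.1 hx
  filter_upwards [eventually_ge_atTop (N' + N)] with j hj
  have h := hN' (j - N) (by omega)
  rw [Nat.sub_add_cancel (by omega : N ≤ j)] at h
  simpa using h

/-- As in Egorov's theorem, the sets where `p j` holds for all `j ≥ N` increase to full measure, and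
inner regularity supplies a compact set inside one of them. -/
theorem exists_isCompact_of_ae_eventually {ρ : Measure ℝ} [IsProbabilityMeasure ρ]
    {p : ℕ → ℝ → Prop} (hp : ∀ j, MeasurableSet {x | p j x})
    (h : ∀ᵐ x ∂ρ, ∀ᶠ j in atTop, p j x) {G : ℝ → Prop} (hG : ∀ᵐ x ∂ρ, G x) {ε : ℝ}
    (hε : 0 < ε) :
    ∃ F : Set ℝ, IsCompact F ∧ 1 - ε ≤ ρ.real F ∧ (∀ x ∈ F, G x) ∧
      ∀ᶠ j in atTop, ∀ x ∈ F, p j x := by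
  obtain ⟨T, hT, hTm, hT0⟩ := exists_measurable_superset_of_null (ae_iff.1 hG)
  set S : ℕ → Set ℝ := fun N => (⋂ j ≥ N, {x | p j x}) \ T with hS
  have hSm : ∀ N, MeasurableSet (S N) := fun N =>
    (MeasurableSet.iInter fun j => MeasurableSet.iInter fun _ => hp j).diff hTm
  have hmono : Monotone S := fun a b hab => Set.sdiff_subset_sdiff_left
    (Set.biInter_subset_biInter_left fun j (hj : b ≤ j) => hab.trans hj)
  have hfull : ρ (⋃ N, S N) = 1 := by
    rw [prob_compl_eq_zero_iff (MeasurableSet.iUnion hSm) |>.symm]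
    have hTae : ∀ᵐ x ∂ρ, x ∉ T := by rw [ae_iff]; simpa using hT0
    have : ∀ᵐ x ∂ρ, x ∈ ⋃ N, S N := by
      filter_upwards [h, hTae] with x hx hxT
      obtain ⟨N, hN⟩ := eventually_atTop.1 hx
      exact Set.mem_iUnion.2 ⟨N, Set.mem_iInter₂.2 hN, hxT⟩
    exact this
  have hlt : ENNReal.ofReal (1 - ε) < 1 := by
    rw [ENNReal.ofReal_lt_one]; linarith
  have htend := tendsto_measure_iUnion_atTop (μ := ρ) hmono
  rw [hfull] at htend
  obtain ⟨N, hN⟩ := (htend.eventually_const_lt hlt).exists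
  obtain ⟨F, hFS, hFc, hF⟩ := (hSm N).exists_lt_isCompact hN
  refine ⟨F, hFc, ?_, fun x hx => ?_, ?_⟩
  · rw [Measure.real, ← ENNReal.ofReal_le_iff_le_toReal (measure_ne_top _ _)]
    exact hF.le
  · by_contra hGx
    exact (hFS hx).2 (hT hGx)
  · filter_upwards [eventually_ge_atTop N] with j hj x hx
    exact Set.mem_iInter₂.1 (hFS hx).1 j hj

end UniformBounds

/-! ### Comparison of logarithmic averages of zeros with an equilibrium potential -/

section Comparison

theorem integral_cond_eq {X : Type*} [MeasurableSpace X] {ρ : Measure X} {F : Set X} (f : X → ℝ) :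
    ∫ x, f x ∂(ProbabilityTheory.cond ρ F) = (ρ.real F)⁻¹ * ∫ x in F, f x ∂ρ := by
  rw [ProbabilityTheory.cond, integral_smul_measure, ENNReal.toReal_inv, smul_eq_mul, Measure.real]

/-- Renormalizing the mass and discarding the complement of `F` each cost at most `1 - ρ.real F`. -/
theorem integral_cond_le {X : Type*} [MeasurableSpace X] {ρ : Measure X} [IsProbabilityMeasure ρ]
    {F : Set X} (hF : MeasurableSet F) (hF0 : 0 < ρ.real F) {f : X → ℝ} (hf : Integrable f ρ)
    (hb : ∀ᵐ x ∂ρ, |f x| ≤ 1) :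
    ∫ x, f x ∂(ProbabilityTheory.cond ρ F) ≤ ∫ x, f x ∂ρ + 2 * (1 - ρ.real F) := by
  have hbF : |∫ x in F, f x ∂ρ| ≤ 1 * ρ.real F := by
    have := norm_setIntegral_le_of_norm_le_const_ae (μ := ρ) (s := F) (f := f) (C := 1)
      (measure_lt_top _ _) (ae_restrict_of_ae hb)
    exact this
  have hbC : |∫ x in Fᶜ, f x ∂ρ| ≤ 1 * ρ.real Fᶜ := by
    have := norm_setIntegral_le_of_norm_le_const_ae (μ := ρ) (s := Fᶜ) (f := f) (C := 1)
      (measure_lt_top _ _) (ae_restrict_of_ae hb)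
    exact this
  rw [probReal_compl_eq_one_sub hF] at hbC
  rw [integral_cond_eq, ← integral_add_compl hF hf]
  set m := ρ.real F
  set a := ∫ x in F, f x ∂ρ
  have h1 : m⁻¹ * a - a ≤ 1 - m := by
    have h2 : m⁻¹ * a - a = (1 - m) * (a / m) := by field_simp
    have h3 : a / m ≤ 1 := by
      rw [div_le_one hF0]; linarith [le_abs_self a]
    have h4 : 0 ≤ 1 - m := sub_nonneg.2 measureReal_le_one
    rw [h2]
    nlinarith
  linarith [neg_abs_le (∫ x in Fᶜ, f x ∂ρ)]

/-- Since `log |x - y| ≤ 2 * R` on `[-R, R]`, the discarded part of `ρ` contributes at most `(1 -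
ρ.real F) * (2 * R)` to the potential. -/
theorem le_integral_cond_log {ρ : Measure ℝ} [IsProbabilityMeasure ρ] {R L : ℝ}
    (hρ : ρ (Set.Icc (-R) R)ᶜ = 0) {F : Set ℝ} (hF : MeasurableSet F) {x : ℝ}
    (hx : x ∈ Set.Icc (-R) R) (hi : Integrable (fun y => Real.log |x - y|) ρ)
    (hL : ∫ y, Real.log |x - y| ∂ρ = L) :
    (ρ.real F)⁻¹ * (L - (1 - ρ.real F) * (2 * R)) ≤
      ∫ y, Real.log |x - y| ∂(ProbabilityTheory.cond ρ F) := by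
  rw [integral_cond_eq]
  refine mul_le_mul_of_nonneg_left ?_ (by positivity)
  rw [← hL, ← integral_add_compl hF hi]
  have hC : ∫ y in Fᶜ, Real.log |x - y| ∂ρ ≤ ∫ _ in Fᶜ, 2 * R ∂ρ := by
    refine setIntegral_mono_ae hi.integrableOn (integrable_const _).integrableOn ?_
    have hK : ∀ᵐ y ∂ρ, y ∈ Set.Icc (-R) R := hρ
    filter_upwards [hK] with y hy
    refine (Real.log_le_self (abs_nonneg _)).trans (abs_le.2 ?_)
    exact ⟨by linarith [hx.1, hy.2], by linarith [hx.2, hy.1]⟩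
  rw [setIntegral_const, probReal_compl_eq_one_sub hF, smul_eq_mul] at hC
  linarith

/-- If a polynomial with zeros `a i` is at most `exp (deg * (L + ε))` on a compact set `F` which
carries almost all of `ρ`, and the logarithmic potential of `ρ` is constant on `F`, then the
logarithmic averages of the zeros are bounded by those of `ρ`. -/
theorem average_log_norm_one_sub_le {ρ : Measure ℝ} [IsProbabilityMeasure ρ] {R L ε : ℝ}
    (hR : 0 < R) (hρ : ρ (Set.Icc (-R) R)ᶜ = 0) (hε : 0 < ε) (hε2 : ε ≤ 1 / 2) {F : Set ℝ}
    (hF : IsCompact F) (hFR : F ⊆ Set.Icc (-R) R) (hρF : 1 - ε ≤ ρ.real F)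
    (hG : ∀ x ∈ F, ρ {x} = 0 ∧ Integrable (fun y => Real.log |x - y|) ρ ∧
      ∫ y, Real.log |x - y| ∂ρ = L)
    {ι : Type*} [Fintype ι] [Nonempty ι] {a : ι → ℝ} (ha : ∀ i, a i ∈ Set.Icc (-R) R)
    (hP : ∀ x ∈ F, ∏ i, |x - a i| ≤ Real.exp (Fintype.card ι * (L + ε)))
    {w : ℂ} (hw : ‖w‖ ≤ 1 / (2 * R)) :
    (Fintype.card ι : ℝ)⁻¹ * ∑ i, Real.log ‖1 - (a i : ℂ) * w‖ ≤
      ∫ x : ℝ, Real.log ‖1 - (x : ℂ) * w‖ ∂ρ + ε * (3 + 4 * R + 2 * |L|) := by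
  rcases eq_or_ne w 0 with rfl | hw0
  · simp only [mul_zero, sub_zero, norm_one, Real.log_one, Finset.sum_const_zero,
      integral_zero, zero_add]
    positivity
  set n : ℝ := ((Fintype.card ι : ℕ) : ℝ) with hn
  have hn0 : 0 < n := by rw [hn]; exact_mod_cast Fintype.card_pos
  have hFm : MeasurableSet F := hF.isClosed.measurableSet
  set m := ρ.real F with hm
  have hm2 : 1 / 2 ≤ m := by linarith
  have hm0 : 0 < m := by linarith
  have hm1 : 0 ≤ 1 - m := sub_nonneg.2 measureReal_le_one
  have hρF0 : ρ F ≠ 0 := fun h0 => by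
    rw [hm, Measure.real, h0] at hm0
    exact lt_irrefl _ hm0
  have hK : ∀ᵐ y ∂ρ, y ∈ Set.Icc (-R) R := hρ
  set σ := ProbabilityTheory.cond ρ F with hσ
  have hσp : IsProbabilityMeasure σ := ProbabilityTheory.cond_isProbabilityMeasure hρF0
  have hσF : σ Fᶜ = 0 := by
    rw [hσ, ProbabilityTheory.cond_apply hFm, Set.inter_compl_self, measure_empty, mul_zero]
  set c := -(m⁻¹ * (L - (1 - m) * (2 * R))) with hc
  have hpot : ∀ z : ℂ, z ∉ ((↑) : ℝ → ℂ) '' F → -c ≤ ∫ t : ℝ, Real.log ‖z - t‖ ∂σ := by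
    intro z hz
    refine neg_le_integral_log_norm_sub hF hσF (fun x hx => ?_) (fun x hx => ?_)
      (fun x hx => ?_) hz
    · exact ProbabilityTheory.cond_absolutelyContinuous (hG x hx).1
    · exact ((hG x hx).2.1.restrict).smul_measure (ENNReal.inv_ne_top.2 hρF0)
    · rw [hc, neg_neg]
      exact le_integral_cond_log hρ hFm (hFR hx) (hG x hx).2.1 (hG x hx).2.2
  have hzR : ∀ t ∈ Set.Icc (-R) R, w⁻¹ ≠ (t : ℂ) := by
    intro t ht h
    have := norm_ofReal_mul_le_half hR ht hw
    rw [← h, inv_mul_cancel₀ hw0, norm_one] at this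
    norm_num at this
  have hzF : w⁻¹ ∉ ((↑) : ℝ → ℂ) '' F := by
    rintro ⟨t, ht, h⟩
    exact hzR t (hFR ht) h.symm
  -- The bound is used at `z = w⁻¹`, of modulus at least `2 * R`, hence away from `F` and from all
  -- zeros. The term `log ‖w⁻¹‖` then cancels because both measures have total mass one.
  have hmain := sum_log_norm_sub_le hF hσF hpot hP hzF fun i => hzR _ (ha i)
  have hsplit : ∀ t ∈ Set.Icc (-R) R, Real.log ‖w⁻¹ - t‖ =
      Real.log ‖w⁻¹‖ + Real.log ‖1 - (t : ℂ) * w‖ := by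
    intro t ht
    have h1 := one_half_le_norm_one_sub (norm_ofReal_mul_le_half hR ht hw)
    rw [← Real.log_mul (norm_ne_zero_iff.2 (inv_ne_zero hw0)) (by linarith), ← norm_mul]
    congr 2
    field_simp
  have hci : Integrable (fun x : ℝ => Real.log ‖1 - (x : ℂ) * w‖) ρ :=
    (continuousOn_log_norm_one_sub hR hw).integrable_of_measure_compl isCompact_Icc hρ
  have hciσ : Integrable (fun x : ℝ => Real.log ‖1 - (x : ℂ) * w‖) σ :=
    hci.restrict.smul_measure (ENNReal.inv_ne_top.2 hρF0)
  have hσint : ∫ t : ℝ, Real.log ‖w⁻¹ - t‖ ∂σ =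
      Real.log ‖w⁻¹‖ + ∫ t : ℝ, Real.log ‖1 - (t : ℂ) * w‖ ∂σ := by
    have hFae : ∀ᵐ t ∂σ, t ∈ F := hσF
    rw [integral_congr_ae (hFae.mono fun t ht => hsplit t (hFR ht)),
      integral_add (integrable_const _) hciσ]
    simp
  have hsum : ∑ i, Real.log ‖w⁻¹ - a i‖ =
      n * Real.log ‖w⁻¹‖ + ∑ i, Real.log ‖1 - (a i : ℂ) * w‖ := by
    rw [Finset.sum_congr rfl fun i _ => hsplit _ (ha i), Finset.sum_add_distrib, Finset.sum_const,
      Finset.card_univ, nsmul_eq_mul]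
  rw [hσint, hsum, ← hn] at hmain
  have h1 : n⁻¹ * ∑ i, Real.log ‖1 - (a i : ℂ) * w‖ ≤
      max (L + ε + c) 0 + ∫ t : ℝ, Real.log ‖1 - (t : ℂ) * w‖ ∂σ := by
    rw [inv_mul_le_iff₀ hn0]
    linarith [mul_add n (max (L + ε + c) 0) (Real.log ‖w⁻¹‖ + ∫ t : ℝ, Real.log ‖1 - (t : ℂ) * w‖ ∂σ),
      mul_add n (Real.log ‖w⁻¹‖) (∫ t : ℝ, Real.log ‖1 - (t : ℂ) * w‖ ∂σ),
      mul_add n (max (L + ε + c) 0) (∫ t : ℝ, Real.log ‖1 - (t : ℂ) * w‖ ∂σ)]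
  have h2 := integral_cond_le hFm hm0 hci (hK.mono fun x hx => by
    have h3 := norm_ofReal_mul_le_half hR hx hw
    exact (abs_log_norm_one_sub_le h3).trans (by linarith))
  -- By the choice of `c`, `L + ε + c` is `ε` plus a multiple of `(1 - m) / m`, which is at most `2
  -- * ε` because `m ≥ 1 / 2`. The remaining `2 * ε` of the final constant is the cost of
  -- conditioning in `h2`.
  have h3 : max (L + ε + c) 0 ≤ ε * (1 + 4 * R + 2 * |L|) := by
    refine max_le ?_ (by positivity)
    have e : L + ε + c = ε + m⁻¹ * (1 - m) * (2 * R - L) := by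
      rw [hc]; field_simp; ring
    have hinv : m⁻¹ ≤ 2 := by
      rw [inv_le_comm₀ hm0 two_pos]; linarith
    have h4 : m⁻¹ * (1 - m) ≤ 2 * ε := mul_le_mul hinv (by linarith) hm1 (by norm_num)
    have h5 : m⁻¹ * (1 - m) * (2 * R - L) ≤ 2 * ε * (2 * R + |L|) := by
      have h6 : 0 ≤ m⁻¹ * (1 - m) := by positivity
      refine (mul_le_mul_of_nonneg_left (by linarith [neg_abs_le L] : 2 * R - L ≤ 2 * R + |L|)
        h6).trans (mul_le_mul_of_nonneg_right h4 (by positivity))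
    rw [e]
    linarith
  linarith

end Comparison

/-! ### Zero counting measures -/

section ZeroCounting

/-- The uniform probability measure on a finite family of reals. -/
noncomputable def averageDirac {n : ℕ} (a : Fin n → ℝ) : Measure ℝ :=
  (n : ℝ≥0∞)⁻¹ • ∑ i, Measure.dirac (a i)

theorem isProbabilityMeasure_averageDirac {n : ℕ} (hn : 0 < n) (a : Fin n → ℝ) :
    IsProbabilityMeasure (averageDirac a) := by
  constructor
  have h0 : (n : ℝ≥0∞) ≠ 0 := by exact_mod_cast hn.ne'
  simp [averageDirac, ENNReal.inv_mul_cancel h0 (ENNReal.natCast_ne_top n)]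

theorem averageDirac_compl_eq_zero {n : ℕ} {a : Fin n → ℝ} {s : Set ℝ} (hs : MeasurableSet s)
    (ha : ∀ i, a i ∈ s) : averageDirac a sᶜ = 0 := by
  have : ∀ i, Measure.dirac (a i) sᶜ = 0 := fun i => by
    rw [Measure.dirac_apply' _ hs.compl]
    simp [ha i]
  simp [averageDirac, this]

theorem integral_averageDirac {n : ℕ} (a : Fin n → ℝ) (f : ℝ → ℝ) :
    ∫ x, f x ∂(averageDirac a) = (n : ℝ)⁻¹ * ∑ i, f (a i) := by
  rw [averageDirac, integral_smul_measure, integral_finsetSum_measure fun i _ =>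
    integrable_dirac (by simp)]
  simp

theorem zeroCountingMeasure_eq_map {p : ℂ[X]} {n : ℕ} {a : Fin n → ℝ} (hp : p.natDegree = n)
    (ha : p.roots = Finset.univ.val.map fun i => (a i : ℂ)) :
    zeroCountingMeasure p = (averageDirac a).map (fun x : ℝ => (x : ℂ)) := by
  have hm : Measurable fun x : ℝ => (x : ℂ) := Complex.measurable_ofReal
  rw [zeroCountingMeasure, averageDirac, Measure.map_smul, ← Measure.mapₗ_apply_of_measurable hm,
    map_sum, hp, ha, Multiset.map_map]
  simp only [Measure.mapₗ_apply_of_measurable hm, Measure.map_dirac' hm]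
  rfl

theorem exists_zeros_monicOP {μ : Measure ℝ} [IsFiniteMeasure μ] (hμ : IsCompact μ.support)
    (hinf : μ.support.Infinite) {R : ℝ} (hR : μ.support ⊆ Set.Icc (-R) R) (n : ℕ) :
    ∃ a : Fin n → ℝ, (∀ i, a i ∈ Set.Icc (-R) R) ∧
      ((monicOP μ n).map (algebraMap ℝ ℂ)).roots = Finset.univ.val.map fun i => (a i : ℂ) := by
  obtain ⟨s, hs, hsR, hroots⟩ := exists_roots_monicOP hμ hinf hR n
  obtain ⟨l, rfl⟩ : ∃ l : List ℝ, (l : Multiset ℝ) = s := ⟨s.toList, s.coe_toList⟩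
  have hl : l.length = n := by simpa using hs
  subst hl
  refine ⟨l.get, fun i => hsR _ (by simp), ?_⟩
  rw [hroots, Fin.univ_val_map, Multiset.map_coe, List.ofFn_comp']
  simp

theorem abs_eval_monicOP {μ : Measure ℝ} {n : ℕ} {a : Fin n → ℝ}
    (ha : ((monicOP μ n).map (algebraMap ℝ ℂ)).roots = Finset.univ.val.map fun i => (a i : ℂ))
    (x : ℝ) : |(monicOP μ n).eval x| = ∏ i, |x - a i| := by
  have h := (IsAlgClosed.splits ((monicOP μ n).map (algebraMap ℝ ℂ))).eval_eq_prod_roots_of_monic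
    ((monicOP_monic μ n).1.map _) (x : ℂ)
  rw [eval_map_ofReal, ha, Multiset.map_map] at h
  have h2 : (((monicOP μ n).eval x : ℝ) : ℂ) = ((∏ i, (x - a i) : ℝ) : ℂ) := by
    rw [h]
    push_cast
    rfl
  rw [Complex.ofReal_injective h2, Finset.abs_prod]

end ZeroCounting

/-! ### Zeros of orthogonal polynomials of minimal growth -/

theorem EssentiallyPerfect.infinite {E : Set ℝ} (hE : EssentiallyPerfect E) (hne : E.Nonempty) :
    E.Infinite := by
  obtain ⟨x, hx⟩ := hne
  intro hfin
  have h := hE.2 x hx 1 one_pos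
  rw [(hfin.subset Set.inter_subset_left).measure_zero] at h
  exact lt_irrefl _ h

theorem nonempty_of_logCapacity_pos {E : Set ℝ} (h : 0 < logCapacity E) : E.Nonempty := by
  by_contra hne
  rw [Set.not_nonempty_iff_eq_empty] at hne
  subst hne
  have hempty : probOn (∅ : Set ℝ) = ∅ := by
    refine Set.eq_empty_of_forall_notMem fun ν hν => ?_
    have := hν.1
    have h1 := hν.2
    rw [Set.compl_empty, measure_univ] at h1
    exact one_ne_zero h1
  simp [logCapacity, hempty] at h

theorem isEquilibriumMeasure_equilibriumMeasure {E : Set ℝ} (hE : IsCompact E)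
    (hne : E.Nonempty) : IsEquilibriumMeasure E (equilibriumMeasure E) := by
  have h := exists_isEquilibriumMeasure hE hne
  rw [equilibriumMeasure, dif_pos h]
  exact h.choose_spec

theorem eLpNorm_eval_ne_top {μ : Measure ℝ} [IsFiniteMeasure μ] (hμ : IsCompact μ.support)
    (p : ℝ[X]) : eLpNorm (fun x => p.eval x) 2 μ ≠ ⊤ := by
  obtain ⟨C, hC⟩ := hμ.exists_bound_of_continuousOn p.continuous.continuousOn
  exact (MemLp.of_bound p.continuous.aestronglyMeasurable C
    (Filter.mem_of_superset Measure.support_mem_ae fun x hx => hC x hx)).eLpNorm_ne_top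

theorem tendsto_integral_averageDirac {μ : Measure ℝ} [IsFiniteMeasure μ]
    (hμ : IsCompact μ.support) {E : Set ℝ} (hE : IsCompact E) (hsub : E ⊆ μ.support)
    {ρ : Measure ℝ} (hρ : IsEquilibriumMeasure E ρ) (hcap : 0 < logCapacity E) (hac : ρ ≪ μ)
    {n : ℕ → ℕ} (hn : StrictMono n) (hn0 : ∀ j, 0 < n j)
    (hlim : Tendsto
      (fun j => (eLpNorm (fun x => (monicOP μ (n j)).eval x) 2 μ).toReal ^ (1 / (n j : ℝ)))
      atTop (𝓝 (logCapacity E)))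
    {R : ℝ} (hR : 0 < R) (hRμ : μ.support ⊆ Set.Icc (-R) R) {a : ∀ j, Fin (n j) → ℝ}
    (haR : ∀ j i, a j i ∈ Set.Icc (-R) R)
    (ha : ∀ j, ((monicOP μ (n j)).map (algebraMap ℝ ℂ)).roots =
      Finset.univ.val.map fun i => (a j i : ℂ))
    {f : ℝ → ℝ} (hf : Continuous f) :
    Tendsto (fun j => ∫ x, f x ∂(averageDirac (a j))) atTop (𝓝 (∫ x, f x ∂ρ)) := by
  have hprob := hρ.1.1
  have hν := fun j => isProbabilityMeasure_averageDirac (hn0 j) (a j)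
  have hνR : ∀ j, averageDirac (a j) (Set.Icc (-R) R)ᶜ = 0 := fun j =>
    averageDirac_compl_eq_zero measurableSet_Icc (haR j)
  have hER : E ⊆ Set.Icc (-R) R := hsub.trans hRμ
  have hρR : ρ (Set.Icc (-R) R)ᶜ = 0 := measure_mono_null (Set.compl_subset_compl.2 hER) hρ.1.2
  refine tendsto_integral_of_tendsto_moment hνR hρR
    (tendsto_moment_of_log_integral_le hR hνR hρR fun δ hδ => ?_) hf
  -- Infinite minimal energy would make the capacity zero.
  have htop : logEnergy ρ ≠ ⊤ := by
    intro h
    rw [hρ.logCapacity_eq, h] at hcap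
    simp at hcap
  obtain ⟨hi, hd⟩ := integrable_of_logEnergy_ne_top hE hρ.1 htop
  set L := ∫ p : ℝ × ℝ, Real.log |p.1 - p.2| ∂(ρ.prod ρ) with hL
  have hcapL : logCapacity E = Real.exp L := by
    rw [hρ.logCapacity_eq, logEnergy_eq_coe_integral hi hd, ← EReal.coe_neg, neg_neg,
      EReal.exp_coe, ENNReal.toReal_ofReal (Real.exp_pos _).le]
  rw [hcapL] at hlim
  set D := 3 + 4 * R + 2 * |L| with hD
  have hD0 : 0 < D := by positivity
  -- The bound `1 / 2` keeps the mass of `F` away from zero, and `δ / D` absorbs the constant of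
  -- `average_log_norm_one_sub_le`.
  set ε := min (1 / 2) (δ / D) with hε
  have hε0 : 0 < ε := lt_min (by norm_num) (by positivity)
  have hεD : ε * D ≤ δ := by
    rw [← le_div_iff₀ hD0]; exact min_le_right _ _
  have hG : ∀ᵐ x ∂ρ, x ∈ E ∧ ρ {x} = 0 ∧ Integrable (fun y => Real.log |x - y|) ρ ∧
      ∫ y, Real.log |x - y| ∂ρ = L := by
    have hEae : ∀ᵐ x ∂ρ, x ∈ E := hρ.1.2
    -- Almost every point has mass zero because the diagonal is null for `ρ × ρ`.
    filter_upwards [hEae, Measure.ae_ae_of_ae_prod hd, hi.prod_right_ae,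
      hρ.ae_integral_log_eq hi hd] with x h1 h2 h3 h4
    refine ⟨h1, ?_, h3, h4⟩
    have h5 : ρ {y | ¬x ≠ y} = 0 := h2
    refine measure_mono_null (fun y hy => ?_) h5
    simp only [Set.mem_singleton_iff] at hy
    simp [hy]
  -- Absolute continuity carries the almost everywhere bound from `μ` to `ρ`.
  have hbd := hac.ae_le (ae_eventually_abs_le (μ := μ)
    (f := fun j x => (monicOP μ (n j)).eval x)
    (fun j => (monicOP μ (n j)).continuous.aestronglyMeasurable)
    (fun j => eLpNorm_eval_ne_top hμ _) hn hn0 hlim hε0)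
  obtain ⟨F, hF, hρF, hGF, hbF⟩ := exists_isCompact_of_ae_eventually
    (fun j => measurableSet_le (monicOP μ (n j)).continuous.abs.measurable measurable_const)
    hbd hG hε0
  filter_upwards [hbF] with j hj w hw
  have : Nonempty (Fin (n j)) := ⟨⟨0, hn0 j⟩⟩
  have h := average_log_norm_one_sub_le hR hρR hε0 (min_le_left _ _) hF
    (fun x hx => hER (hGF x hx).1) hρF (fun x hx => (hGF x hx).2) (haR j)
    (fun x hx => by
      rw [← abs_eval_monicOP (ha j), Fintype.card_fin]
      exact hj x hx) hw
  rw [Fintype.card_fin] at h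
  rw [integral_averageDirac]
  linarith

theorem theorem4p2 (μ : Measure ℝ) [IsFiniteMeasure μ] (hμ : IsCompact μ.support)
    (E : Set ℝ) (hE : IsCompact E) (hsub : E ⊆ μ.support) (hperf : EssentiallyPerfect E)
    (hcap : 0 < logCapacity E)
    (hac : Measure.AbsolutelyContinuous (equilibriumMeasure E) μ)
    (n : ℕ → ℕ) (hn : StrictMono n)
    (hlim : Tendsto
      (fun j => (eLpNorm (fun x => (monicOP μ (n j)).eval x) 2 μ).toReal ^ (1 / (n j : ℝ)))
      atTop (𝓝 (logCapacity E))) :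
    ConvergesWeakly
      (fun j => zeroCountingMeasure ((monicOP μ (n j)).map (algebraMap ℝ ℂ)))
      ((equilibriumMeasure E).map (fun x : ℝ => (x : ℂ))) := by
  intro f
  have hne := nonempty_of_logCapacity_pos hcap
  -- An infinite support makes every denominator of the Gram-Schmidt recursion positive, so the
  -- polynomials are indeed orthogonal.
  have hinf : μ.support.Infinite := (hperf.infinite hne).mono hsub
  obtain ⟨C, hC⟩ := hμ.isBounded.exists_norm_le
  set R := max C 1 with hR
  have hR0 : 0 < R := lt_max_of_lt_right one_pos
  have hRμ : μ.support ⊆ Set.Icc (-R) R := fun x hx =>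
    abs_le.1 ((hC x hx).trans (le_max_left _ _))
  -- The first term is dropped because `n 0` may be `0`, where the zero counting measure is not a
  -- probability measure.
  choose a haR ha using fun j => exists_zeros_monicOP hμ hinf hRμ (n (j + 1))
  have hshift : StrictMono fun j => n (j + 1) := fun i j hij => hn (by omega)
  have hmain := tendsto_integral_averageDirac hμ hE hsub
    (isEquilibriumMeasure_equilibriumMeasure hE hne) hcap hac hshift
    (fun j => (Nat.zero_le _).trans_lt (hn j.lt_succ_self))
    (hlim.comp (tendsto_add_atTop_nat 1)) hR0 hRμ haR ha
    (f.continuous.comp Complex.continuous_ofReal)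
  have hmap : ∀ τ : Measure ℝ, ∫ z, f z ∂(τ.map fun x : ℝ => (x : ℂ)) = ∫ x : ℝ, f x ∂τ :=
    fun τ => integral_map Complex.measurable_ofReal.aemeasurable
      f.continuous.aestronglyMeasurable
  rw [← tendsto_add_atTop_iff_nat 1, hmap]
  refine hmain.congr fun j => ?_
  simp only
  rw [zeroCountingMeasure_eq_map (by rw [natDegree_map, (monicOP_monic μ _).2]) (ha j), hmap]
  rfl
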